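/- All algebras and vector spaces are finite-dimensional over a field $k$ of characteristic zero. For a Lie algebra $\mathfrak n$ let $Z(\mathfrak n)$ be its center, $\mathfrak n^2=[\mathfrak n,\mathfrak n]$, and let $\mathfrak n^{[1]}$ be the span of all $\delta(x)$ and $\mathfrak n^{[i+1]}$ the span of all $\delta(x)$ with $x\in\mathfrak n^{[i]}$, where $\delta$ runs over $\mathrm{Der}\,\mathfrak n$; $\mathfrak n$ is characteristically nilpotent if $\mathfrak n^{[i]}=0$ for some $i\ge 1$. The nilindex of a nilpotent Lie algebra $N$ is the largest $t$ with $N^t\ne 0$, where $N^1=N$, $N^{j+1}=[N,N^j]$. A Lie algebra $L$ with radical $R$ is faithful if, for a Levi subalgebra $S$ of $L$ (a semisimple subalgebra with $L=S\oplus R$ as vector spaces), the adjoint representation of $S$ on $R$ is faithful. For a Lie subalgebra $S\subseteq\mathrm{Der}\,R$, $S\oplus_{id}R$ denotes the semidirect sum with $[\delta,r]=\delta(r)$ for $\delta\in S$, $r\in R$. **Proposition.** Let $\mathfrak n$ be a characteristically nilpotent Lie algebra with $\{x\in\mathfrak n:[x,\mathfrak n]\subseteq Z(\mathfrak n)\}\subseteq\mathfrak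 n^2$, let $0\ne z_0\in Z(\mathfrak n)$, let $n\ge 1$, and let $V_n$ be a vector space with basis $x_1,\dots,x_n,y_1,\dots,y_n$. Let $b$ be the alternating form on $V_n$ with $b(x_i,y_j)=\delta_{ij}$ and $b(x_i,x_j)=b(y_i,y_j)=0$. Let $\mathcal L_n=\mathcal L_n(\mathfrak n,z_0)=\mathfrak n\oplus V_n$ with the bracket that extends the one of $\mathfrak n$ and satisfies $[V_n,\mathfrak n]=0$ and $[u,v]=b(u,v)z_0$ for $u,v\in V_n$. Then: 1. $\mathfrak n$ and $\mathcal L_n$ are nilpotent Lie algebras of the same nilindex. 2. $\mathrm{Der}\,\mathcal L_n=\mathfrak{sp}_{2n}(V_n,b)^\star\oplus\mathfrak N$ (direct sum of vector spaces), where $$\mathfrak{sp}_{2n}(V_n,b)^\star=\{\delta\in\mathfrak{gl}(\mathcal L_n):\ \delta|_{V_n}\in\mathfrak{sp}_{2n}(V_n,b),\ \delta|_{\mathfrak n}=0\}$$ is a Lie subalgebra and $\mathfrak N=\mathfrak N_0\oplus\mathfrak N_1$ with $$\mathfrak N_0=\{\delta\in\mathfrak{gl}(\mathcal L_n):\ \delta|_{V_n}=0,\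 \delta|_{\mathfrak n}\in\mathrm{Der}\,\mathfrak n,\ \delta(z_0)=0\},$$ $$\mathfrak N_1=\{\delta\in\mathfrak{gl}(\mathcal L_n):\ \delta(V_n)\subseteq\mathfrak n^2,\ \delta(\mathfrak n)\subseteq V_n,\ \delta|_{\mathfrak n^2}=0,\ [\delta(u),a]=-b(u,\delta(a))z_0\ \text{ for all } u\in V_n,\ a\in\mathfrak n\}.$$ 3. $\mathfrak N$ is a nilpotent ideal of $\mathrm{Der}\,\mathcal L_n$, and every element of $\mathfrak N$ is a nilpotent linear operator on $\mathcal L_n$. 4. Every faithful Lie algebra whose radical is isomorphic to $\mathcal L_n$ is isomorphic to $S\oplus_{id}\mathcal L_n$ for some semisimple (possibly zero) Lie subalgebra $S$ of $\mathfrak{sp}_{2n}(V_n,b)^\star$. -/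

import Mathlib

universe u v w x

attribute [local instance 100] LieRing.ofAssociativeRing

namespace CharNilp

section General

variable (k : Type u) [Field k] (𝔫 : Type v) [LieRing 𝔫] [LieAlgebra k 𝔫]

/-- The series `𝔫^[0] = 𝔫`, `𝔫^[i+1] = 𝔇(𝔫^[i])`, where `𝔇 = Der 𝔫` and `𝔇(U)` is the set of all
finite sums of elements `δ x` with `δ ∈ 𝔇`, `x ∈ U`. -/
def derSeries : ℕ → Submodule k 𝔫
  | 0 => ⊤
  | i + 1 => Submodule.span k
      {y | ∃ δ : LieDerivation k 𝔫 𝔫, ∃ x ∈ derSeries i, δ x = y}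

/-- `𝔫` is characteristically nilpotent: `𝔫^[i] = 0` for some `i ≥ 1`. -/
def IsCharNilpotent : Prop := ∃ i : ℕ, 1 ≤ i ∧ derSeries k 𝔫 i = ⊥

/-- The derived ideal `𝔫² = [𝔫, 𝔫]`. -/
def derivedIdeal : LieIdeal k 𝔫 := ⁅(⊤ : LieIdeal k 𝔫), (⊤ : LieIdeal k 𝔫)⁆

/-- A Levi subalgebra of `L`: a subalgebra `S` with zero radical (i.e. semisimple, in
characteristic zero) such that `L = S ⊕ Rad L` as vector spaces. -/
def IsLeviSubalgebra {L : Type w} [LieRing L] [LieAlgebra k L] (S : LieSubalgebra k L) : Prop :=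
  LieAlgebra.HasTrivialRadical k S ∧
    IsCompl S.toSubmodule (LieAlgebra.radical k L).toSubmodule

/-- `L` is faithful: the adjoint representation `s ↦ (r ↦ [s, r])` of a Levi subalgebra on the
radical of `L` is faithful, whichever Levi subalgebra is taken. -/
def IsFaithfulLie (L : Type w) [LieRing L] [LieAlgebra k L] : Prop :=
  ∀ S : LieSubalgebra k L, IsLeviSubalgebra k S →
    Function.Injective (LieModule.toEnd k S (LieAlgebra.radical k L))

end General

section Form

variable {k : Type u} [Field k] {V : Type w} [AddCommGroup V] [Module k V] {n : ℕ}

/-- The alternating form with `b(x_i, y_j) = δ_ij = -b(y_j, x_i)`, `b(x_i, x_j) = b(y_i, y_j) = 0`,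
for the basis `x_i = e (inl i)`, `y_i = e (inr i)` of `V`. -/
noncomputable def sympForm (e : Module.Basis (Fin n ⊕ Fin n) k V) : LinearMap.BilinForm k V :=
  Matrix.toBilin e (Matrix.fromBlocks 0 1 (-1) 0)

theorem sympForm_apply (e : Module.Basis (Fin n ⊕ Fin n) k V) (u v : V) :
    sympForm e u v = ∑ i : Fin n, (e.repr u (Sum.inl i) * e.repr v (Sum.inr i)
      - e.repr u (Sum.inr i) * e.repr v (Sum.inl i)) := by
  simp [sympForm, Matrix.toBilin_apply, Fintype.sum_sum_type, Matrix.one_apply,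
    sub_eq_add_neg, Finset.sum_add_distrib, add_comm]

theorem sympForm_self (e : Module.Basis (Fin n ⊕ Fin n) k V) (u : V) : sympForm e u u = 0 := by
  rw [sympForm_apply]
  exact Finset.sum_eq_zero fun i _ => by ring

theorem sympForm_inl_inr (e : Module.Basis (Fin n ⊕ Fin n) k V) (i j : Fin n) :
    sympForm e (e (Sum.inl i)) (e (Sum.inr j)) = if i = j then 1 else 0 := by
  simp [sympForm_apply, Finsupp.single_apply]

theorem sympForm_inl_inl (e : Module.Basis (Fin n ⊕ Fin n) k V) (i j : Fin n) :
    sympForm e (e (Sum.inl i)) (e (Sum.inl j)) = 0 := by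
  simp [sympForm_apply]

theorem sympForm_inr_inr (e : Module.Basis (Fin n ⊕ Fin n) k V) (i j : Fin n) :
    sympForm e (e (Sum.inr i)) (e (Sum.inr j)) = 0 := by
  simp [sympForm_apply]

end Form

variable {k : Type u} [Field k] {𝔫 : Type v} [LieRing 𝔫] [LieAlgebra k 𝔫]
  {V : Type w} [AddCommGroup V] [Module k V] {n : ℕ}

/-- The vector space `ℒ_n(𝔫, z₀) = 𝔫 ⊕ V_n`, for a central element `z₀` of `𝔫` and a
`2n`-dimensional space `V_n` with basis `e = (x_1, …, x_n, y_1, …, y_n)`: an element `a + u` is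
given by its components `a` and `u`. -/
@[ext] structure GluedAlgebra (z₀ : LieAlgebra.center k 𝔫)
    (e : Module.Basis (Fin n ⊕ Fin n) k V) : Type (max v w) where
  /-- The component in `𝔫`. -/
  alg : 𝔫
  /-- The component in `V_n`. -/
  vec : V

namespace GluedAlgebra

variable (z₀ : LieAlgebra.center k 𝔫) (e : Module.Basis (Fin n ⊕ Fin n) k V)

/-- The underlying set is `𝔫 × V_n`; the vector space structure is componentwise. -/
def toProd : GluedAlgebra z₀ e ≃ 𝔫 × V where
  toFun p := (p.alg, p.vec)
  invFun p := ⟨p.1, p.2⟩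
  left_inv _ := rfl
  right_inv _ := rfl

instance : AddCommGroup (GluedAlgebra z₀ e) := (toProd z₀ e).addCommGroup

instance : Module k (GluedAlgebra z₀ e) := (toProd z₀ e).module k

/-- The product `[a + u, a' + u'] = [a, a'] + b(u, u') z₀` for `a, a' ∈ 𝔫` and `u, u' ∈ V_n`. -/
noncomputable instance : Bracket (GluedAlgebra z₀ e) (GluedAlgebra z₀ e) where
  bracket p q := ⟨⁅p.alg, q.alg⁆ + sympForm e p.vec q.vec • (z₀ : 𝔫), 0⟩

variable {z₀ e}

@[simp] theorem lie_alg (p q : GluedAlgebra z₀ e) :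
    ⁅p, q⁆.alg = ⁅p.alg, q.alg⁆ + sympForm e p.vec q.vec • (z₀ : 𝔫) := rfl

@[simp] theorem lie_vec (p q : GluedAlgebra z₀ e) : ⁅p, q⁆.vec = 0 := rfl

@[simp] theorem zero_alg : (0 : GluedAlgebra z₀ e).alg = 0 := rfl

@[simp] theorem zero_vec : (0 : GluedAlgebra z₀ e).vec = 0 := rfl

@[simp] theorem add_alg (p q : GluedAlgebra z₀ e) : (p + q).alg = p.alg + q.alg := rfl

@[simp] theorem add_vec (p q : GluedAlgebra z₀ e) : (p + q).vec = p.vec + q.vec := rfl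

@[simp] theorem neg_alg (p : GluedAlgebra z₀ e) : (-p).alg = -p.alg := rfl

@[simp] theorem neg_vec (p : GluedAlgebra z₀ e) : (-p).vec = -p.vec := rfl

@[simp] theorem smul_alg (c : k) (p : GluedAlgebra z₀ e) : (c • p).alg = c • p.alg := rfl

@[simp] theorem smul_vec (c : k) (p : GluedAlgebra z₀ e) : (c • p).vec = c • p.vec := rfl

theorem lie_center (a : 𝔫) : ⁅a, (z₀ : 𝔫)⁆ = 0 :=
  (LieModule.mem_maxTrivSubmodule k 𝔫 𝔫 (z₀ : 𝔫)).1 z₀.2 a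

theorem center_lie (a : 𝔫) : ⁅(z₀ : 𝔫), a⁆ = 0 := by
  rw [← lie_skew, lie_center, neg_zero]

noncomputable instance : LieRing (GluedAlgebra z₀ e) where
  add_lie p q r := by
    ext
    · simp [add_smul]; abel
    · simp
  lie_add p q r := by
    ext
    · simp [add_smul]; abel
    · simp
  lie_self p := by
    ext
    · simp [sympForm_self]
    · simp
  leibniz_lie p q r := by
    ext
    · simp [lie_center, center_lie]
    · simp

noncomputable instance : LieAlgebra k (GluedAlgebra z₀ e) where
  lie_smul c p q := by
    ext
    · simp [mul_smul]
    · simp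

variable (z₀ e)

/-- The inclusion of `𝔫` as a subalgebra of `ℒ_n(𝔫, z₀)`. -/
noncomputable def ofAlg : 𝔫 →ₗ⁅k⁆ GluedAlgebra z₀ e where
  toFun a := ⟨a, 0⟩
  map_add' a b := by ext <;> simp
  map_smul' c a := by ext <;> simp
  map_lie' {a b} := by ext <;> simp

/-- The inclusion of `V_n` in `ℒ_n(𝔫, z₀)`. -/
noncomputable def ofVec : V →ₗ[k] GluedAlgebra z₀ e where
  toFun u := ⟨0, u⟩
  map_add' a b := by ext <;> simp
  map_smul' c a := by ext <;> simp

@[simp] theorem ofAlg_alg (a : 𝔫) : (ofAlg z₀ e a).alg = a := rfl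

@[simp] theorem ofAlg_vec (a : 𝔫) : (ofAlg z₀ e a).vec = 0 := rfl

@[simp] theorem ofVec_alg (u : V) : (ofVec z₀ e u).alg = 0 := rfl

@[simp] theorem ofVec_vec (u : V) : (ofVec z₀ e u).vec = u := rfl

theorem lie_ofVec_ofVec (u v : V) :
    ⁅ofVec z₀ e u, ofVec z₀ e v⁆ = sympForm e u v • ofAlg z₀ e (z₀ : 𝔫) := by
  ext <;> simp

theorem lie_ofVec_ofAlg (u : V) (a : 𝔫) : ⁅ofVec z₀ e u, ofAlg z₀ e a⁆ = 0 := by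
  ext <;> simp

/-- `𝔰𝔭(V_n, b)^⋆`: the endomorphisms `δ` of `ℒ_n(𝔫, z₀)` with `δ|_{V_n} ∈ 𝔰𝔭(V_n, b)` (in
particular `δ(V_n) ⊆ V_n`) and `δ|_𝔫 = 0`. -/
noncomputable def spStar : LieSubalgebra k (Module.End k (GluedAlgebra z₀ e)) where
  carrier := {δ | (∃ f ∈ skewAdjointLieSubalgebra (sympForm e),
      ∀ u, δ (ofVec z₀ e u) = ofVec z₀ e (f u)) ∧ ∀ a, δ (ofAlg z₀ e a) = 0}
  zero_mem' := ⟨⟨0, zero_mem _, by simp⟩, by simp⟩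
  add_mem' := by
    rintro δ ε ⟨⟨f, hf, hδ⟩, hδ'⟩ ⟨⟨g, hg, hε⟩, hε'⟩
    exact ⟨⟨f + g, add_mem hf hg, by simp [hδ, hε]⟩, by simp [hδ', hε']⟩
  smul_mem' := by
    rintro c δ ⟨⟨f, hf, hδ⟩, hδ'⟩
    exact ⟨⟨c • f, (skewAdjointLieSubalgebra (sympForm e)).smul_mem c hf, by simp [hδ]⟩,
      by simp [hδ']⟩
  lie_mem' := by
    rintro δ ε ⟨⟨f, hf, hδ⟩, hδ'⟩ ⟨⟨g, hg, hε⟩, hε'⟩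
    exact ⟨⟨⁅f, g⁆, (skewAdjointLieSubalgebra (sympForm e)).lie_mem hf hg,
      by simp [Ring.lie_def, hδ, hε]⟩, by simp [Ring.lie_def, hδ', hε']⟩

/-- The endomorphisms `δ` of `ℒ_n(𝔫, z₀)` with `δ|_{V_n} = 0`, `δ|_𝔫 ∈ Der 𝔫` (in particular
`δ(𝔫) ⊆ 𝔫`) and `δ(z₀) = 0`. -/
noncomputable def nilEven : Submodule k (Module.End k (GluedAlgebra z₀ e)) where
  carrier := {δ | (∀ u, δ (ofVec z₀ e u) = 0) ∧
    (∃ D : LieDerivation k 𝔫 𝔫, ∀ a, δ (ofAlg z₀ e a) = ofAlg z₀ e (D a)) ∧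
    δ (ofAlg z₀ e (z₀ : 𝔫)) = 0}
  zero_mem' := ⟨by simp, ⟨0, by simp⟩, by simp⟩
  add_mem' := by
    rintro δ ε ⟨h1, ⟨D, hD⟩, h2⟩ ⟨h3, ⟨E, hE⟩, h4⟩
    exact ⟨by simp [h1, h3], ⟨D + E, by simp [hD, hE]⟩, by simp [h2, h4]⟩
  smul_mem' := by
    rintro c δ ⟨h1, ⟨D, hD⟩, h2⟩
    exact ⟨by simp [h1], ⟨c • D, by simp [hD]⟩, by simp [h2]⟩

/-- The endomorphisms `δ` of `ℒ_n(𝔫, z₀)` with `δ(V_n) ⊆ 𝔫²`, `δ(𝔫) ⊆ V_n`, `δ|_{𝔫²} = 0` and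
`[δ(u), a] = -b(u, δ(a)) z₀` for all `u ∈ V_n` and `a ∈ 𝔫`. -/
noncomputable def nilOdd : Submodule k (Module.End k (GluedAlgebra z₀ e)) where
  carrier := {δ | (∀ u, ∃ c ∈ derivedIdeal k 𝔫, δ (ofVec z₀ e u) = ofAlg z₀ e c) ∧
    (∀ a, ∃ v, δ (ofAlg z₀ e a) = ofVec z₀ e v) ∧
    (∀ a ∈ derivedIdeal k 𝔫, δ (ofAlg z₀ e a) = 0) ∧
    ∀ (u : V) (a : 𝔫), ⁅δ (ofVec z₀ e u), ofAlg z₀ e a⁆ =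
      -(sympForm e u (δ (ofAlg z₀ e a)).vec • ofAlg z₀ e (z₀ : 𝔫))}
  zero_mem' := ⟨fun _ => ⟨0, zero_mem _, by simp⟩, fun _ => ⟨0, by simp⟩, by simp, by simp⟩
  add_mem' := by
    rintro δ ε ⟨h1, h2, h3, h4⟩ ⟨g1, g2, g3, g4⟩
    refine ⟨fun u => ?_, fun a => ?_, fun a ha => by simp [h3 a ha, g3 a ha], fun u a => ?_⟩
    · obtain ⟨c, hc, hc'⟩ := h1 u
      obtain ⟨d, hd, hd'⟩ := g1 u
      exact ⟨c + d, add_mem hc hd, by simp [hc', hd']⟩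
    · obtain ⟨c, hc⟩ := h2 a
      obtain ⟨d, hd⟩ := g2 a
      exact ⟨c + d, by simp [hc, hd]⟩
    · have h : ((δ + ε) (ofAlg z₀ e a)).vec =
          ((δ (ofAlg z₀ e a)).vec + (ε (ofAlg z₀ e a)).vec : V) := rfl
      rw [h, LinearMap.add_apply, add_lie, h4, g4, map_add, add_smul, neg_add]
  smul_mem' := by
    rintro c δ ⟨h1, h2, h3, h4⟩
    refine ⟨fun u => ?_, fun a => ?_, fun a ha => by simp [h3 a ha], fun u a => ?_⟩
    · obtain ⟨d, hd, hd'⟩ := h1 u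
      exact ⟨c • d, (derivedIdeal k 𝔫).toSubmodule.smul_mem c hd, by simp [hd']⟩
    · obtain ⟨d, hd⟩ := h2 a
      exact ⟨c • d, by simp [hd]⟩
    · have h : ((c • δ) (ofAlg z₀ e a)).vec = (c • (δ (ofAlg z₀ e a)).vec : V) := rfl
      rw [h, LinearMap.smul_apply, smul_lie, h4, map_smul, smul_neg, smul_eq_mul, mul_smul]

/-- The space `𝔑`, the sum of the two spaces above. -/
noncomputable def nilPart : Submodule k (Module.End k (GluedAlgebra z₀ e)) := nilEven z₀ e ⊔ nilOdd z₀ e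

/-- `Der ℒ_n(𝔫, z₀)` as a subalgebra of `𝔤𝔩(ℒ_n(𝔫, z₀))`. -/
noncomputable def der : LieSubalgebra k (Module.End k (GluedAlgebra z₀ e)) :=
  (LieDerivation.toLinearMapLieHom k (GluedAlgebra z₀ e)).range

end GluedAlgebra

end CharNilp

/-! Write a derivation `δ` of `ℒ_n` in blocks: `α : 𝔫 → 𝔫`, `β : 𝔫 → V`, `γ : V → 𝔫`, `f : V → V`.
The Leibniz rule on `𝔫 × 𝔫` makes `α` a derivation and `β` zero on `𝔫²`. On `V × 𝔫` it gives `[γ u,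
a] = -b(u, β a) z₀`, which is central, so the hypothesis on `𝔫` forces `γ(V) ⊆ 𝔫²`. On `V × V` it
makes `z₀` an eigenvector of `δ`; since every derivation of `𝔫` is nilpotent, the eigenvalue is `0`,
so `δ z₀ = 0` and `f` is symplectic. The pieces `f`, `α` and `(β, γ)` are the three summands of `Der
ℒ_n`.

Derivations respect the flag `ℒ_n ⊇ 𝔫² + V`, with graded action `α` on the quotient and `f` on `(𝔫²
+ V)/𝔫²`. Thus `𝔑` is cut out by `f = 0`. It is an ideal, its elements are nilpotent because the
powers of `α` vanish, and Engel's theorem makes it a nilpotent Lie algebra. The nilindices agree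
because `z₀` already lies in `𝔫²`.

For the last assertion, Levi's theorem splits off a semisimple `g` acting on `ℒ_n` by derivations. A
semisimple algebra acting by nilpotent operators acts trivially, so `g` kills `𝔫²` and `ℒ_n/(𝔫² +
V)`. The decomposition of `ℒ_n` into invariants and `g · ℒ_n` then yields an element of `𝔑_1` whose
exponential is an automorphism conjugating the action into `𝔰𝔭(V_n, b)^⋆`
(`exists_conj_mem_spStar`). Faithfulness identifies `g` with its image there. Levi's theorem and the
splitting off of invariants are derived from Cartan's criterion by way of a Casimir operator. -/

section

open LieAlgebra LieModule Module

/-! ### Solvable extensions, Engel's theorem, and the quotient by the radical -/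

section Solvable

variable {k : Type*} [Field k] {L : Type*} [LieRing L] [LieAlgebra k L]
  {L' : Type*} [LieRing L'] [LieAlgebra k L']

/-- An extension of a solvable Lie algebra by a solvable ideal is solvable. -/
theorem LieHom.isSolvable_of_isSolvable_ker (f : L →ₗ⁅k⁆ L') [IsSolvable f.ker] [IsSolvable L'] :
    IsSolvable L := by
  obtain ⟨a, ha⟩ := IsSolvable.solvable k f.ker
  obtain ⟨b, hb⟩ := IsSolvable.solvable k L'
  rw [LieIdeal.derivedSeries_eq_bot_iff] at ha
  refine IsSolvable.mk (R := k) (k := a + b) ?_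
  rw [derivedSeries_def, derivedSeriesOfIdeal_add]
  refine le_bot_iff.1 (ha ▸ derivedSeriesOfIdeal_mono ?_ a)
  have := LieIdeal.derivedSeries_map_le (f := f) b
  rw [hb, LieIdeal.map_le_iff_le_comap] at this
  intro x hx
  simpa using this hx

theorem LieAlgebra.isSolvable_of_isSolvable_derivedSeries_one
    [h : IsSolvable (derivedSeries k L 1)] : IsSolvable L := by
  obtain ⟨a, ha⟩ := IsSolvable.solvable k (derivedSeries k L 1)
  rw [LieIdeal.derivedSeries_eq_bot_iff, derivedSeries_def, ← derivedSeriesOfIdeal_add] at ha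
  exact IsSolvable.mk ha

/-- A Lie algebra with a faithful representation by nilpotent operators is nilpotent. -/
theorem LieAlgebra.isNilpotent_of_injective_of_isNilpotent [IsNoetherian k L] {A : Type*} [Ring A]
    [Algebra k A] (f : L →ₗ⁅k⁆ A) (hf : Function.Injective f) (h : ∀ x, _root_.IsNilpotent (f x)) :
    LieRing.IsNilpotent L := by
  rw [LieAlgebra.isNilpotent_iff_forall (R := k)]
  intro x
  obtain ⟨m, hm⟩ := LieAlgebra.ad_nilpotent_of_nilpotent (R := k) (h x)
  refine ⟨m, LinearMap.ext fun y => hf ?_⟩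
  have key : ∀ m : ℕ, f (((ad k L x) ^ m) y) = ((ad k A (f x)) ^ m) (f y) := by
    intro m
    induction m with
    | zero => simp
    | succ m ih => simp [pow_succ', ih]
  rw [key, hm]
  simp

/-- The image of a Lie algebra modulo its radical has trivial radical. -/
theorem LieHom.hasTrivialRadical_of_ker_eq_radical [IsNoetherian k L] (f : L →ₗ⁅k⁆ L')
    (hf : Function.Surjective f) (hker : f.ker = radical k L) : HasTrivialRadical k L' := by
  refine hasTrivialRadical_of_no_solvable_ideals fun I hI => ?_
  let g : LieIdeal.comap f I →ₗ⁅k⁆ I :=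
    { toFun := fun x => ⟨f x, x.2⟩
      map_add' := fun x y => by ext; simp
      map_smul' := fun c x => by ext; simp
      map_lie' := fun {x y} => by ext; simp }
  have : IsSolvable f.ker := hker ▸ inferInstance
  let j : g.ker →ₗ⁅k⁆ f.ker :=
    { toFun := fun x => ⟨x.1.1, by
        have := x.2
        rw [LieHom.mem_ker] at this ⊢
        exact congrArg Subtype.val this⟩
      map_add' := fun x y => rfl
      map_smul' := fun c x => rfl
      map_lie' := fun {x y} => rfl }
  have hj : Function.Injective j := fun x y h =>
    Subtype.ext (Subtype.ext (congrArg (fun z : f.ker => (z : L)) h))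
  have := hj.lieAlgebra_isSolvable
  have hs : IsSolvable (LieIdeal.comap f I) := g.isSolvable_of_isSolvable_ker
  rw [LieIdeal.solvable_iff_le_radical, ← hker] at hs
  rw [LieSubmodule.eq_bot_iff]
  intro y hy
  obtain ⟨x, rfl⟩ := hf y
  exact LieHom.mem_ker.1 (hs (LieIdeal.mem_comap.2 hy))

end Solvable

/-! ### Cartan's criterion and the Casimir operator -/

section Casimir

variable {k : Type*} [Field k] [CharZero k] {g : Type*} [LieRing g] [LieAlgebra k g]
  [FiniteDimensional k g] {M : Type*} [AddCommGroup M] [Module k M] [FiniteDimensional k M]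

/-- A faithful representation of an ideal with zero trace form makes the ideal solvable. -/
theorem LieModule.isSolvable_of_traceForm_eq_zero {L : Type*} [LieRing L] [LieAlgebra k L]
    [FiniteDimensional k L] [LieRingModule L M] [LieModule k L M] [IsFaithful k L M]
    (h : traceForm k L M = 0) : IsSolvable L := by
  -- Cartan's criterion: the derived algebra acts by nilpotent operators, so by faithfulness and
  -- Engel it is nilpotent.
  have h1 := LieModule.isNilpotent_derivedSeries_of_traceForm_eq_zero h
  rw [LieModule.isNilpotent_iff_forall' (R := k)] at h1
  have : LieRing.IsNilpotent (derivedSeries k L 1) := by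
    refine LieAlgebra.isNilpotent_of_injective_of_isNilpotent
      (toEnd k (derivedSeries k L 1) M) ?_ h1
    intro x y hxy
    exact Subtype.ext (IsFaithful.injective_toEnd (R := k) (L := L) (M := M) hxy)
  exact LieAlgebra.isSolvable_of_isSolvable_derivedSeries_one (k := k)

variable [LieRingModule g M] [LieModule k g M]

/-- On the Killing complement of the kernel of a representation of a semisimple Lie algebra, the
trace form is nondegenerate. -/
theorem LieModule.eq_zero_of_mem_killingCompl_ker [HasTrivialRadical k g] {x : g}
    (hx : x ∈ (LieModule.ker k g M).killingCompl)
    (h : ∀ y ∈ (LieModule.ker k g M).killingCompl, traceForm k g M x y = 0) : x = 0 := by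
  set J := LieModule.ker k g M
  set J' := J.killingCompl
  have hc : IsCompl J J' := J.isCompl_killingCompl
  have hJ : ∀ z ∈ J, ∀ y, traceForm k g M y z = 0 := by
    intro z hz y
    have : toEnd k g M z = 0 := LinearMap.ext fun m => (LieModule.mem_ker k g M z).1 hz m
    simp [traceForm_apply_apply, this]
  -- `K` is the radical of the trace form on `J'`. As `J` acts by zero, `K` is orthogonal to all of
  -- `g`; as `J ⊓ J' = ⊥`, it acts faithfully. Cartan's criterion makes it solvable, hence zero.
  let K : LieIdeal k g :=
    LieAlgebra.InvariantForm.orthogonal (traceForm k g M) (traceForm_lieInvariant k g M) J' ⊓ J'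
  have hK : ∀ z, z ∈ K → ∀ y, traceForm k g M y z = 0 := by
    intro z hz y
    have hy : y ∈ J ⊔ J' := hc.sup_eq_top ▸ LieSubmodule.mem_top y
    obtain ⟨a, ha, b, hb, rfl⟩ := (LieSubmodule.mem_sup _ _ _).1 hy
    rw [map_add, LinearMap.add_apply, traceForm_comm, hJ a ha, zero_add]
    exact (LieAlgebra.InvariantForm.mem_orthogonal _ _ _ _).1 hz.1 b hb
  have : IsFaithful k K M := by
    rw [isFaithful_iff']
    intro z hz
    have h1 : (z : g) ∈ J := (LieModule.mem_ker k g M _).2 hz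
    have h2 : (z : g) ∈ J ⊓ J' := ⟨h1, z.2.2⟩
    rw [hc.inf_eq_bot] at h2
    exact Subtype.ext h2
  have : IsSolvable K := isSolvable_of_traceForm_eq_zero (k := k) (M := M) (by
    ext a b
    exact hK b b.2 a)
  have hK0 : K = ⊥ := HasTrivialRadical.eq_bot_of_isSolvable K
  have hxK : x ∈ K :=
    ⟨(LieAlgebra.InvariantForm.mem_orthogonal _ _ _ _).2 fun y hy => by
      rw [traceForm_comm]; exact h y hy, hx⟩
  rw [hK0] at hxK
  exact hxK

/-- A Casimir operator of a nontrivial representation of a semisimple Lie algebra. -/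
theorem LieModule.exists_casimir [HasTrivialRadical k g] (hM : ¬ IsTrivial g M) :
    ∃ C : End k M, (∀ x : g, Commute C (toEnd k g M x)) ∧
      (∀ m, C m ∈ ⁅(⊤ : LieIdeal k g), (⊤ : LieSubmodule k g M)⁆) ∧
      (∀ m ∈ maxTrivSubmodule k g M, C m = 0) ∧ LinearMap.trace k M C ≠ 0 := by
  classical
  set J := LieModule.ker k g M
  set J' := J.killingCompl
  have hc : IsCompl J J' := J.isCompl_killingCompl
  let B : LinearMap.BilinForm k J' := (traceForm k g M).restrict J'.toSubmodule
  have hBs : B.IsSymm := ⟨fun a b => traceForm_comm k g M a b⟩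
  have hB : B.Nondegenerate := by
    refine hBs.isRefl.nondegenerate_iff_separatingLeft.2 ?_
    intro a ha
    exact Subtype.ext (eq_zero_of_mem_killingCompl_ker a.2 fun y hy => ha ⟨y, hy⟩)
  let b := Module.finBasis k J'
  let b' := B.dualBasis hB b
  have hb : ∀ y : J', y = ∑ j, B (b' j) y • b j := by
    intro y
    conv_lhs => rw [← b.sum_repr y]
    refine Finset.sum_congr rfl fun j _ => ?_
    congr 1
    have h1 := LinearMap.BilinForm.dualBasis_repr_apply hB b' y j
    rw [LinearMap.BilinForm.dualBasis_dualBasis hB hBs b] at h1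
    rw [h1, hBs.eq]
  have hb' : ∀ y : J', y = ∑ j, B y (b j) • b' j := by
    intro y
    conv_lhs => rw [← b'.sum_repr y]
    refine Finset.sum_congr rfl fun j _ => ?_
    rw [LinearMap.BilinForm.dualBasis_repr_apply]
  let φ := toEnd k g M
  refine ⟨∑ i, φ (b i) * φ (b' i), fun x => ?_, fun m => ?_, fun m hm => ?_, ?_⟩
  -- By invariance of the form, the matrix of `ad x` in the dual basis is minus the transpose of its
  -- matrix in `b`, so the two sums cancel.
  · let c : Fin (finrank k J') → Fin (finrank k J') → k := fun i j => B (b' j) ⁅x, b i⁆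
    have h1 : ∀ i, ⁅φ x, φ (b i)⁆ = ∑ j, c i j • φ (b j) := by
      intro i
      have := congrArg (fun y : J' => φ y) (hb ⁅x, b i⁆)
      simpa [φ] using this
    have h2 : ∀ i, ⁅φ x, φ (b' i)⁆ = ∑ j, (-c j i) • φ (b' j) := by
      intro i
      have := congrArg (fun y : J' => φ y) (hb' ⁅x, b' i⁆)
      have hinv : ∀ j, B ⁅x, b' i⁆ (b j) = -c j i :=
        fun j => traceForm_apply_lie_apply' k g M x (b' i) (b j)
      simpa [φ, hinv] using this
    rw [commute_iff_lie_eq, ← lie_skew, neg_eq_zero]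
    have h3 : ∀ i, ⁅φ x, φ (b i) * φ (b' i)⁆ =
        ∑ j, c i j • (φ (b j) * φ (b' i)) - ∑ j, c j i • (φ (b i) * φ (b' j)) := by
      intro i
      have : ⁅φ x, φ (b i) * φ (b' i)⁆ =
          ⁅φ x, φ (b i)⁆ * φ (b' i) + φ (b i) * ⁅φ x, φ (b' i)⁆ := by
        simp only [Ring.lie_def]; noncomm_ring
      rw [this, h1, h2]
      simp [Finset.sum_mul, Finset.mul_sum, sub_eq_add_neg]
    rw [lie_sum, Finset.sum_congr rfl fun i _ => h3 i, Finset.sum_sub_distrib,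
      Finset.sum_comm, sub_self]
  · rw [LinearMap.sum_apply]
    exact sum_mem fun i _ => LieSubmodule.lie_mem_lie (LieSubmodule.mem_top _)
      (LieSubmodule.mem_top _)
  · rw [LinearMap.sum_apply]
    refine Finset.sum_eq_zero fun i _ => ?_
    have : φ (b' i) m = 0 := hm _
    simp [this]
  -- The trace of the Casimir operator is the dimension of `J'`, which is positive because the
  -- representation is nontrivial.
  · have : ∀ i, LinearMap.trace k M (φ (b i) * φ (b' i)) = 1 := by
      intro i
      have := LinearMap.BilinForm.apply_dualBasis_right hB hBs b i i
      rw [if_pos rfl] at this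
      exact this
    rw [map_sum, Finset.sum_congr rfl fun i _ => this i]
    simp only [Finset.sum_const, Finset.card_univ, Fintype.card_fin, nsmul_eq_mul, mul_one]
    rw [Nat.cast_ne_zero, ← Nat.pos_iff_ne_zero, Module.finrank_pos_iff]
    by_contra hcon
    rw [not_nontrivial_iff_subsingleton] at hcon
    refine hM ⟨fun x m => ?_⟩
    have hJ' : J' = ⊥ := by
      rw [LieSubmodule.eq_bot_iff]
      intro y hy
      exact congrArg Subtype.val (Subsingleton.elim (⟨y, hy⟩ : J') 0)
    have : x ∈ J := by
      have := hc.sup_eq_top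
      rw [hJ', sup_bot_eq] at this
      rw [this]; trivial
    exact (LieModule.mem_ker k g M x).1 this m

end Casimir

/-! ### Splitting off the invariants of a representation -/

section FixedPoints

variable {k : Type*} [Field k] [CharZero k] {g : Type*} [LieRing g] [LieAlgebra k g]
  [FiniteDimensional k g] [HasTrivialRadical k g]

/-- Induction on the dimension through the Fitting decomposition of a Casimir operator `C`: the
image of a high power lies in `g · M`, while its kernel is a smaller module containing all
invariants. -/
theorem LieModule.isCompl_maxTrivSubmodule_of_finrank_eq (d : ℕ) :
    ∀ (M : Type w) [AddCommGroup M] [Module k M] [FiniteDimensional k M]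
      [LieRingModule g M] [LieModule k g M], finrank k M = d →
      IsCompl (maxTrivSubmodule k g M) ⁅(⊤ : LieIdeal k g), (⊤ : LieSubmodule k g M)⁆ := by
  induction d using Nat.strong_induction_on with
  | _ d ih =>
    intro M _ _ _ _ _ hd
    by_cases hM : IsTrivial g M
    · have h1 := (isTrivial_iff_max_triv_eq_top k g M).1 hM
      rw [← h1, ideal_oper_maxTrivSubmodule_eq_bot, h1]
      exact isCompl_top_bot
    obtain ⟨C, hC, hC1, hC2, hC3⟩ := exists_casimir (k := k) hM
    -- The exponent must be at least `1`, so that the range lies in `g · M` and the kernel contains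
    -- `ker C`.
    obtain ⟨n, hn, hn1⟩ := (C.eventually_isCompl_ker_pow_range_pow.and
      (Filter.eventually_ge_atTop 1)).exists
    obtain ⟨n, rfl⟩ := Nat.exists_eq_succ_of_ne_zero (Nat.one_le_iff_ne_zero.1 hn1)
    have hCn : ∀ x : g, ∀ m, (C ^ (n + 1)) ⁅x, m⁆ = ⁅x, (C ^ (n + 1)) m⁆ := fun x m =>
      LinearMap.congr_fun ((hC x).pow_left (n + 1)).eq m
    let K : LieSubmodule k g M :=
      { LinearMap.ker (C ^ (n + 1)) with
        lie_mem := fun {x m} hm => by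
          have hm' : (C ^ (n + 1)) m = 0 := hm
          change (C ^ (n + 1)) ⁅x, m⁆ = 0
          rw [hCn, hm', lie_zero] }
    let I : LieSubmodule k g M :=
      { LinearMap.range (C ^ (n + 1)) with
        lie_mem := fun {x m} hm => by
          obtain ⟨y, rfl⟩ := hm
          exact ⟨⁅x, y⁆, hCn x y⟩ }
    have hKI : IsCompl K I := LieSubmodule.isCompl_toSubmodule.1 hn
    have hI : I ≤ ⁅(⊤ : LieIdeal k g), (⊤ : LieSubmodule k g M)⁆ := by
      rintro _ ⟨y, rfl⟩
      rw [pow_succ']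
      exact hC1 _
    have hlt : finrank k K < d := by
      rw [← hd]
      refine Submodule.finrank_lt (s := LinearMap.ker (C ^ (n + 1))) ?_
      -- If the kernel were everything, `C` would be nilpotent, against its nonzero trace.
      intro h
      refine hC3 (LinearMap.isNilpotent_trace_of_isNilpotent ⟨n + 1, ?_⟩).eq_zero
      exact LinearMap.ker_eq_top.1 h
    have hK := ih _ hlt K rfl
    have hmap : (⁅(⊤ : LieIdeal k g), (⊤ : LieSubmodule k g K)⁆).map K.incl =
        ⁅(⊤ : LieIdeal k g), K⁆ := by
      rw [LieSubmodule.map_bracket_eq]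
      congr 1
      simp
    constructor
    · rw [disjoint_iff, LieSubmodule.eq_bot_iff]
      rintro m ⟨hm1, hm2⟩
      have hmK : m ∈ K := by
        change (C ^ (n + 1)) m = 0
        rw [pow_succ]
        change (C ^ n) (C m) = 0
        rw [hC2 m hm1, map_zero]
      have h1 : m ∈ ⁅(⊤ : LieIdeal k g), K⁆ ⊔ I := by
        rw [← hKI.sup_eq_top, LieSubmodule.lie_sup] at hm2
        exact sup_le_sup_left (LieSubmodule.lie_le_right _ _) _ hm2
      obtain ⟨s, hs, i, hi, rfl⟩ := (LieSubmodule.mem_sup _ _ _).1 h1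
      have hsK : s ∈ K := LieSubmodule.lie_le_right _ _ hs
      have hiK : i ∈ K ⊓ I := ⟨by simpa using sub_mem hmK hsK, hi⟩
      rw [hKI.inf_eq_bot] at hiK
      obtain rfl : i = 0 := hiK
      rw [add_zero] at hm1 ⊢
      rw [← hmap] at hs
      obtain ⟨s, hs2, rfl⟩ := (LieSubmodule.mem_map _).1 hs
      have : s ∈ maxTrivSubmodule k g K ⊓ ⁅(⊤ : LieIdeal k g), (⊤ : LieSubmodule k g K)⁆ :=
        ⟨fun x => Subtype.ext (hm1 x), hs2⟩
      rw [hK.inf_eq_bot] at this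
      obtain rfl : s = 0 := this
      simp
    · rw [codisjoint_iff, eq_top_iff]
      intro m _
      have hm : m ∈ K ⊔ I := hKI.sup_eq_top ▸ LieSubmodule.mem_top m
      obtain ⟨a, ha, i, hi, rfl⟩ := (LieSubmodule.mem_sup _ _ _).1 hm
      have ha' : (⟨a, ha⟩ : K) ∈
          maxTrivSubmodule k g K ⊔ ⁅(⊤ : LieIdeal k g), (⊤ : LieSubmodule k g K)⁆ :=
        by
        rw [hK.sup_eq_top]
        trivial
      obtain ⟨t, ht, s, hs, hts⟩ := (LieSubmodule.mem_sup _ _ _).1 ha'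
      have ha2 : a = (t : M) + s := congrArg Subtype.val hts.symm
      have hs' : (s : M) ∈ ⁅(⊤ : LieIdeal k g), K⁆ := by
        rw [← hmap]
        exact (LieSubmodule.mem_map _).2 ⟨s, hs, rfl⟩
      rw [ha2, add_assoc]
      refine (LieSubmodule.mem_sup _ _ _).2 ⟨t, ?_, s + i, ?_, rfl⟩
      · exact fun x => congrArg Subtype.val (ht x)
      · exact add_mem (LieSubmodule.mono_lie_right _ le_top hs') (hI hi)

/-- If `L` acts on `M` through a semisimple quotient, then `M` is the direct sum of the space of
invariants and of the space spanned by all `⁅x, m⁆`. -/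
theorem LieModule.isCompl_maxTrivSubmodule_lie_top {L : Type*} [LieRing L] [LieAlgebra k L]
    {M : Type w} [AddCommGroup M] [Module k M] [FiniteDimensional k M]
    [LieRingModule L M] [LieModule k L M] (p : L →ₗ⁅k⁆ g) (hp : Function.Surjective p)
    (hker : ∀ x, p x = 0 → ∀ m : M, ⁅x, m⁆ = 0) :
    IsCompl (maxTrivSubmodule k L M) ⁅(⊤ : LieIdeal k L), (⊤ : LieSubmodule k L M)⁆ := by
  have key : ∀ x y, p x = p y → ∀ m : M, ⁅x, m⁆ = ⁅y, m⁆ := by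
    intro x y h m
    rw [← sub_eq_zero, ← sub_lie]
    exact hker _ (by rw [map_sub, h, sub_self]) m
  -- A merely set-theoretic section suffices to define the action of `g`, since elements with the
  -- same image act in the same way.
  let σ : g → L := Function.surjInv hp
  have hσ : ∀ x, p (σ x) = x := Function.surjInv_eq hp
  let i1 : LieRingModule g M :=
    { bracket := fun x m => ⁅σ x, m⁆
      add_lie := fun x y m => (key _ (σ x + σ y) (by simp [hσ]) m).trans (add_lie _ _ _)
      lie_add := fun x m m' => lie_add (σ x) m m'
      leibniz_lie := fun x y m => by
        have := key (σ ⁅x, y⁆) ⁅σ x, σ y⁆ (by simp [hσ]) m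
        change ⁅σ x, ⁅σ y, m⁆⁆ = ⁅σ ⁅x, y⁆, m⁆ + ⁅σ y, ⁅σ x, m⁆⁆
        rw [this, lie_lie, sub_add_cancel] }
  have i2 : @LieModule k g M _ _ _ _ _ i1 :=
    { smul_lie := fun c x m => (key _ (c • σ x) (by simp [hσ]) m).trans (smul_lie _ _ _)
      lie_smul := fun c x m => lie_smul c (σ x) m }
  have hbr : ∀ (x : L) (m : M), ⁅p x, m⁆ = ⁅x, m⁆ := fun x m => key _ _ (hσ _) m
  have h := @isCompl_maxTrivSubmodule_of_finrank_eq k _ _ g _ _ _ _ _ M _ _ _ i1 i2 rfl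
  rw [← LieSubmodule.isCompl_toSubmodule] at h ⊢
  convert h using 1
  · ext m
    exact ⟨fun hm x => hm (σ x), fun hm x => (hbr x m).symm.trans (hm (p x))⟩
  · rw [LieSubmodule.lieIdeal_oper_eq_linear_span', LieSubmodule.lieIdeal_oper_eq_linear_span']
    congr 1
    ext m
    constructor
    · rintro ⟨x, -, n, -, rfl⟩
      exact ⟨p x, trivial, n, trivial, hbr x n⟩
    · rintro ⟨x, -, n, -, rfl⟩
      exact ⟨σ x, trivial, n, trivial, rfl⟩

end FixedPoints

/-! ### Levi's theorem -/

section Levi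

variable {k : Type*} [Field k] {g : Type*} [LieRing g] [LieAlgebra k g]
  {L : Type x} [LieRing L] [LieAlgebra k L]

/-- The quotient map by an ideal, as a homomorphism of Lie algebras. -/
def LieIdeal.quotientMk (I : LieIdeal k L) : L →ₗ⁅k⁆ L ⧸ I :=
  { I.toSubmodule.mkQ with map_lie' := rfl }

theorem LieIdeal.quotientMk_surjective (I : LieIdeal k L) : Function.Surjective I.quotientMk :=
  I.toSubmodule.mkQ_surjective

theorem LieIdeal.quotientMk_eq_zero (I : LieIdeal k L) {y : L} : I.quotientMk y = 0 ↔ y ∈ I :=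
  Submodule.Quotient.mk_eq_zero I.toSubmodule

theorem LieIdeal.ker_quotientMk (I : LieIdeal k L) : I.quotientMk.ker = I := by
  ext y
  rw [LieHom.mem_ker, quotientMk_eq_zero]

/-- A homomorphism which is trivial on an ideal factors through the quotient. -/
def LieIdeal.quotientLift (I : LieIdeal k L) (p : L →ₗ⁅k⁆ g) (h : I ≤ p.ker) : L ⧸ I →ₗ⁅k⁆ g :=
  { I.toSubmodule.liftQ (p : L →ₗ[k] g) h with
    map_lie' := fun {a b} => by
      obtain ⟨a, rfl⟩ := I.quotientMk_surjective a
      obtain ⟨b, rfl⟩ := I.quotientMk_surjective b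
      exact p.map_lie a b }

theorem LieIdeal.quotientLift_mk (I : LieIdeal k L) (p : L →ₗ⁅k⁆ g) (h : I ≤ p.ker) (y : L) :
    I.quotientLift p h (I.quotientMk y) = p y := rfl

theorem LieHom.isSolvable_ker_comp_incl (p : L →ₗ⁅k⁆ g) [IsSolvable p.ker]
    (H : LieSubalgebra k L) : IsSolvable (p.comp H.incl).ker := by
  let j : (p.comp H.incl).ker →ₗ⁅k⁆ p.ker :=
    { toFun := fun x => ⟨x.1.1, x.2⟩
      map_add' := fun x y => rfl
      map_smul' := fun c x => rfl
      map_lie' := fun {x y} => rfl }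
  have hj : Function.Injective j := fun x y h =>
    Subtype.ext (Subtype.ext (congrArg (fun z : p.ker => (z : L)) h))
  exact hj.lieAlgebra_isSolvable

theorem LieHom.isSolvable_ker_quotientLift (I : LieIdeal k L) (p : L →ₗ⁅k⁆ g) (h : I ≤ p.ker)
    [IsSolvable p.ker] : IsSolvable (I.quotientLift p h).ker := by
  let j : p.ker →ₗ⁅k⁆ (I.quotientLift p h).ker :=
    { toFun := fun x => ⟨I.quotientMk x, x.2⟩
      map_add' := fun x y => rfl
      map_smul' := fun c x => rfl
      map_lie' := fun {x y} => rfl }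
  have hj : Function.Surjective j := by
    rintro ⟨y, hy⟩
    obtain ⟨y, rfl⟩ := I.quotientMk_surjective y
    exact ⟨⟨y, hy⟩, rfl⟩
  exact hj.lieAlgebra_isSolvable

theorem LieIdeal.eq_bot_of_lie_self_eq (I : LieIdeal k L) [IsSolvable I] (h : ⁅I, I⁆ = I) :
    I = ⊥ := by
  obtain ⟨n, hn⟩ := IsSolvable.solvable k I
  rw [LieIdeal.derivedSeries_eq_bot_iff] at hn
  have : ∀ m, derivedSeriesOfIdeal k L m I = I := by
    intro m
    induction m with
    | zero => rfl
    | succ m ih => rw [derivedSeriesOfIdeal_succ, ih, h]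
  rw [← hn, this]

variable [CharZero k] [FiniteDimensional k g] [HasTrivialRadical k g] [FiniteDimensional k L]

/-- A central extension of a semisimple Lie algebra splits. -/
theorem LieHom.exists_section_of_central (p : L →ₗ⁅k⁆ g) (hp : Function.Surjective p)
    (hc : ∀ r, p r = 0 → ∀ y : L, ⁅r, y⁆ = 0) : ∃ s : g →ₗ⁅k⁆ L, ∀ y, p (s y) = y := by
  have h := isCompl_maxTrivSubmodule_lie_top (M := L) p hp hc
  -- The adjoint action factors through `g`, so `L` is the direct sum of its center and `[L, L]`.
  -- The center maps to the center of `g`, which is zero, so `p` restricts to a bijection from `[L,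
  -- L]` to `g`.
  let H : LieIdeal k L := ⁅(⊤ : LieIdeal k L), (⊤ : LieIdeal k L)⁆
  have hinj : ∀ z ∈ H, p z = 0 → z = 0 := by
    intro z hz hz0
    have : z ∈ maxTrivSubmodule k L L ⊓ H :=
      ⟨fun y => by rw [← lie_skew, hc z hz0, neg_zero], hz⟩
    rw [h.inf_eq_bot] at this
    exact this
  have hsurj : ∀ y, ∃ z ∈ H, p z = y := by
    intro y
    obtain ⟨z, rfl⟩ := hp y
    have hz : z ∈ maxTrivSubmodule k L L ⊔ H := by rw [h.sup_eq_top]; trivial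
    obtain ⟨a, ha, b, hb, rfl⟩ := (LieSubmodule.mem_sup _ _ _).1 hz
    refine ⟨b, hb, ?_⟩
    have : p a ∈ center k g := by
      intro y
      obtain ⟨y, rfl⟩ := hp y
      rw [← LieHom.map_lie, ha y, map_zero]
    rw [center_eq_bot] at this
    have h0 : p a = 0 := this
    rw [map_add, h0, zero_add]
  choose s hs hps using hsurj
  have huniq : ∀ z ∈ H, ∀ y, p z = y → z = s y := fun z hz y h => by
    rw [← sub_eq_zero]
    exact hinj _ (sub_mem hz (hs y)) (by rw [map_sub, hps, h, sub_self])
  refine ⟨{ toFun := s, map_add' := fun a b => ?_, map_smul' := fun c a => ?_,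
            map_lie' := fun {a b} => ?_ }, hps⟩
  · exact (huniq _ (add_mem (hs a) (hs b)) _ (by simp [hps])).symm
  · exact (huniq _ (H.smul_mem c (hs a)) _ (by simp [hps])).symm
  · exact (huniq _ (H.lie_mem (hs b)) _ (by simp [hps])).symm

/-- In a noncentral extension of a semisimple Lie algebra by an abelian ideal there is a proper
subalgebra which maps onto the quotient. -/
theorem LieHom.exists_subalgebra_of_abelian (p : L →ₗ⁅k⁆ g) (hp : Function.Surjective p)
    (hab : ∀ a b, p a = 0 → p b = 0 → ⁅a, b⁆ = 0)
    (hc : ¬ ∀ r, p r = 0 → ∀ y : L, ⁅r, y⁆ = 0) :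
    ∃ H : LieSubalgebra k L, H ≠ ⊤ ∧ ∀ y, ∃ z ∈ H, p z = y := by
  have hR : ∀ (y : L) {r}, p r = 0 → p ⁅y, r⁆ = 0 := fun y r hr => by
    rw [LieHom.map_lie, hr, lie_zero]
  -- With `R = ker p`: `A` consists of the maps `L → R` that are scalar on `R`, `B` of those
  -- vanishing on `R`, and `C` of the operators `ad r` with `r ∈ R`. For `a ∈ R`, the action of `a`
  -- sends `A` into `C`, so `A/C` is a module over `g`.
  let A : LieSubmodule k L (End k L) :=
    { carrier := {φ | (∀ z, p (φ z) = 0) ∧ ∃ c : k, ∀ r, p r = 0 → φ r = c • r}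
      zero_mem' := ⟨fun z => by simp, 0, by simp⟩
      add_mem' := by
        rintro φ ψ ⟨h1, c, h2⟩ ⟨h3, d, h4⟩
        exact ⟨fun z => by simp [h1, h3], c + d, fun r hr => by simp [h2 r hr, h4 r hr, add_smul]⟩
      smul_mem' := by
        rintro a φ ⟨h1, c, h2⟩
        exact ⟨fun z => by simp [h1], a * c, fun r hr => by simp [h2 r hr, mul_smul]⟩
      lie_mem := by
        rintro y φ ⟨h1, c, h2⟩
        refine ⟨fun z => ?_, 0, fun r hr => ?_⟩
        · simp [h1]
        · simp [h2 r hr, h2 _ (hR y hr)] }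
  let C : LieSubmodule k L (End k L) :=
    { carrier := {φ | ∃ r, p r = 0 ∧ ∀ z, φ z = ⁅r, z⁆}
      zero_mem' := ⟨0, by simp⟩
      add_mem' := by
        rintro φ ψ ⟨r, hr, h⟩ ⟨s, hs, h'⟩
        exact ⟨r + s, by simp [hr, hs], fun z => by simp [h, h']⟩
      smul_mem' := by
        rintro a φ ⟨r, hr, h⟩
        exact ⟨a • r, by simp [hr], fun z => by simp [h]⟩
      lie_mem := by
        rintro y φ ⟨r, hr, h⟩
        exact ⟨⁅y, r⁆, hR y hr, fun z => by simp [h]⟩ }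
  let B : LieSubmodule k L A :=
    { carrier := {φ | ∀ r, p r = 0 → φ.1 r = 0}
      zero_mem' := fun r _ => rfl
      add_mem' := fun {φ ψ} h h' r hr => by simp [h r hr, h' r hr]
      smul_mem' := fun c φ h r hr => by simp [h r hr]
      lie_mem := fun {y φ} h r hr => by simp [h r hr, h _ (hR y hr)] }
  have hB : ⁅(⊤ : LieIdeal k L), (⊤ : LieSubmodule k L A)⁆ ≤ B := by
    rw [LieSubmodule.lie_le_iff]
    rintro y - ⟨φ, h1, c, h2⟩ - r hr
    simp [h2 r hr, h2 _ (hR y hr)]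
  let C' : LieSubmodule k L A := C.comap A.incl
  have hker : ∀ a, p a = 0 → ∀ φ ∈ A, ∃ c : k, (∀ r, p r = 0 → φ r = c • r) ∧
      ∀ z, ⁅a, φ⁆ z = ⁅-(c • a), z⁆ := by
    rintro a ha φ ⟨h1, c, h2⟩
    refine ⟨c, h2, fun z => ?_⟩
    have : p ⁅a, z⁆ = 0 := by rw [LieHom.map_lie, ha, zero_lie]
    simp [hab a _ ha (h1 z), h2 _ this]
  have h := isCompl_maxTrivSubmodule_lie_top (M := A ⧸ C') p hp (by
    intro a ha φ
    obtain ⟨φ, rfl⟩ := LieSubmodule.Quotient.surjective_mk' C' φ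
    rw [← LieModuleHom.map_lie, LieSubmodule.Quotient.mk_eq_zero]
    obtain ⟨c, -, hc⟩ := hker a ha φ φ.2
    exact ⟨-(c • a), by simp [ha], hc⟩)
  -- Start from a linear projection `φ₀` onto `R` and make it invariant modulo `C` by subtracting
  -- some `ψ` in `L · A ⊆ B`. The correction vanishes on `R`, so `φ` is still a projection onto `R`.
  obtain ⟨f, hf⟩ := LinearMap.exists_leftInverse_of_injective
    (LinearMap.ker (p : L →ₗ[k] g)).subtype (Submodule.ker_subtype _)
  let φ₀ : A := ⟨(LinearMap.ker (p : L →ₗ[k] g)).subtype ∘ₗ f, fun z => (f z).2, 1, fun r hr => by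
    have := LinearMap.congr_fun hf ⟨r, hr⟩
    rw [one_smul]
    exact congrArg Subtype.val this⟩
  have hφ₀ : LieSubmodule.Quotient.mk' C' φ₀ ∈ maxTrivSubmodule k L (A ⧸ C') ⊔
      ⁅(⊤ : LieIdeal k L), (⊤ : LieSubmodule k L (A ⧸ C'))⁆ := by rw [h.sup_eq_top]; trivial
  obtain ⟨t, ht, s, hs, hts⟩ := (LieSubmodule.mem_sup _ _ _).1 hφ₀
  have hmap : (⁅(⊤ : LieIdeal k L), (⊤ : LieSubmodule k L A)⁆).map
      (LieSubmodule.Quotient.mk' C') =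
      ⁅(⊤ : LieIdeal k L), (⊤ : LieSubmodule k L (A ⧸ C'))⁆ := by
    rw [LieSubmodule.map_bracket_eq]
    congr 1
    rw [LieModuleHom.map_top, LieSubmodule.Quotient.range_mk']
  rw [← hmap] at hs
  obtain ⟨ψ, hψ, rfl⟩ := (LieSubmodule.mem_map _).1 hs
  obtain ⟨φ, hφA⟩ : ∃ φ : A, φ = φ₀ - ψ := ⟨_, rfl⟩
  have hφt : LieSubmodule.Quotient.mk' C' φ = t := by
    rw [hφA, map_sub, ← hts, add_sub_cancel_right]
  have hφ1 : ∀ r, p r = 0 → φ.1 r = r := by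
    intro r hr
    have h1 : φ₀.1 r = r := congrArg Subtype.val (LinearMap.congr_fun hf ⟨r, hr⟩)
    have h2 : ψ.1 r = 0 := hB hψ r hr
    simp [hφA, h1, h2]
  have hφC : ∀ y : L, ∃ r, p r = 0 ∧ ∀ z, ⁅y, φ.1⁆ z = ⁅r, z⁆ := by
    intro y
    have := ht y
    rw [← hφt, ← LieModuleHom.map_lie, LieSubmodule.Quotient.mk_eq_zero] at this
    exact this
  have hφr : ∀ r, p r = 0 → ∀ z, ⁅r, φ.1⁆ z = -⁅r, z⁆ := by
    intro r hr z
    have : p ⁅r, z⁆ = 0 := by rw [LieHom.map_lie, hr, zero_lie]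
    simp [hab r _ hr (φ.2.1 z), hφ1 _ this]
  -- `H` is the stabilizer of `φ`. Since `r ∈ R` sends `φ` to `-ad r`, `H = L` would make `R`
  -- central; and each `y` sends `φ` to some `ad r`, so `y + r` lies in `H`.
  let H : LieSubalgebra k L :=
    { carrier := {y | ⁅y, φ.1⁆ = 0}
      zero_mem' := zero_lie _
      add_mem' := fun {a b} ha hb => by
        have ha' : ⁅a, φ.1⁆ = 0 := ha
        have hb' : ⁅b, φ.1⁆ = 0 := hb
        change ⁅a + b, φ.1⁆ = 0
        rw [add_lie, ha', hb', add_zero]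
      smul_mem' := fun c a ha => by
        have ha' : ⁅a, φ.1⁆ = 0 := ha
        change ⁅c • a, φ.1⁆ = 0
        rw [smul_lie, ha', smul_zero]
      lie_mem' := fun {a b} ha hb => by
        have ha' : ⁅a, φ.1⁆ = 0 := ha
        have hb' : ⁅b, φ.1⁆ = 0 := hb
        change ⁅⁅a, b⁆, φ.1⁆ = 0
        rw [lie_lie, ha', hb', lie_zero, lie_zero, sub_zero] }
  refine ⟨H, fun hH => hc fun r hr y => ?_, fun y => ?_⟩
  · have : r ∈ H := by rw [hH]; trivial
    have h1 : ⁅r, φ.1⁆ = 0 := this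
    have h2 := hφr r hr y
    rw [h1, LinearMap.zero_apply] at h2
    exact neg_eq_zero.1 h2.symm
  · obtain ⟨y, rfl⟩ := hp y
    obtain ⟨r, hr, h⟩ := hφC y
    refine ⟨y + r, ?_, by simp [hr]⟩
    change ⁅y + r, φ.1⁆ = 0
    ext z
    rw [add_lie, LinearMap.add_apply, h, hφr r hr, add_neg_cancel, LinearMap.zero_apply]

/-- By induction on the dimension it is enough to find a proper subalgebra mapping onto `g`. If the
kernel is abelian, this is possible unless it is central, when a section exists directly. Otherwise,
divide by the derived algebra of the kernel. -/
theorem LieHom.exists_section_of_finrank_eq (d : ℕ) :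
    ∀ (L : Type x) [LieRing L] [LieAlgebra k L] [FiniteDimensional k L], finrank k L = d →
      ∀ p : L →ₗ⁅k⁆ g, Function.Surjective p → IsSolvable p.ker →
      ∃ s : g →ₗ⁅k⁆ L, ∀ y, p (s y) = y := by
  induction d using Nat.strong_induction_on with
  | _ d ih =>
    intro L _ _ _ hd p hp hsol
    have hsub : ∀ H : LieSubalgebra k L, H ≠ ⊤ → (∀ y, ∃ z ∈ H, p z = y) →
        ∃ s : g →ₗ⁅k⁆ L, ∀ y, p (s y) = y := by
      intro H hH hpH
      have hlt : finrank k H < d := by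
        rw [← hd]
        refine Submodule.finrank_lt (s := H.toSubmodule) fun h => hH ?_
        rwa [LieSubalgebra.toSubmodule_eq_top] at h
      obtain ⟨s, hs⟩ := ih _ hlt H rfl (p.comp H.incl) (fun y => by
        obtain ⟨z, hz, rfl⟩ := hpH y
        exact ⟨⟨z, hz⟩, rfl⟩) (p.isSolvable_ker_comp_incl H)
      exact ⟨H.incl.comp s, hs⟩
    by_cases hab : ⁅p.ker, p.ker⁆ = ⊥
    · have hab' : ∀ a b, p a = 0 → p b = 0 → ⁅a, b⁆ = 0 := fun a b ha hb => by
        rw [LieSubmodule.lie_eq_bot_iff] at hab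
        exact hab a (LieHom.mem_ker.2 ha) b (LieHom.mem_ker.2 hb)
      by_cases hc : ∀ r, p r = 0 → ∀ y : L, ⁅r, y⁆ = 0
      · exact p.exists_section_of_central hp hc
      · obtain ⟨H, hH, hpH⟩ := p.exists_subalgebra_of_abelian hp hab' hc
        exact hsub H hH hpH
    · set D : LieIdeal k L := ⁅p.ker, p.ker⁆ with hD
      have hDle : D ≤ p.ker := LieSubmodule.lie_le_right _ _
      have hlt : finrank k (L ⧸ D) < d := by
        have h1 := Submodule.finrank_quotient_add_finrank D.toSubmodule
        have h2 : finrank k D.toSubmodule ≠ 0 := by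
          rw [Ne, Submodule.finrank_eq_zero]
          simpa using hab
        have h3 : finrank k (L ⧸ D) = finrank k (L ⧸ D.toSubmodule) := rfl
        omega
      have : FiniteDimensional k (L ⧸ D) :=
        inferInstanceAs (FiniteDimensional k (L ⧸ D.toSubmodule))
      obtain ⟨s, hs⟩ := ih _ hlt (L ⧸ D) rfl (D.quotientLift p hDle) (fun y => by
        obtain ⟨z, rfl⟩ := hp y
        exact ⟨D.quotientMk z, rfl⟩) (LieHom.isSolvable_ker_quotientLift D p hDle)
      -- The preimage in `L` of the section of `L ⧸ D`. Were it all of `L`, the kernel would equal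
      -- its own derived algebra, and a solvable ideal of this kind is zero.
      refine hsub (s.range.comap D.quotientMk) (fun htop => hab ?_) fun y => ?_
      · have hDeq : D = p.ker := by
          refine le_antisymm hDle fun r hr => ?_
          have : r ∈ s.range.comap D.quotientMk := by rw [htop]; trivial
          obtain ⟨y, hy⟩ := this
          have hy0 : y = 0 := by
            have hy' : s y = D.quotientMk r := hy
            rw [← hs y, hy']
            exact hr
          rw [← D.quotientMk_eq_zero]
          exact hy.symm.trans (by rw [hy0]; exact s.map_zero)
        have := p.ker.eq_bot_of_lie_self_eq hDeq
        rw [hDeq, this]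
      · obtain ⟨z, hz⟩ := D.quotientMk_surjective (s y)
        exact ⟨z, ⟨y, hz.symm⟩, by rw [← D.quotientLift_mk p hDle, hz, hs]⟩

/-- **Levi's theorem**: a homomorphism onto a semisimple Lie algebra with solvable kernel has a
section. -/
theorem LieHom.exists_section_of_isSolvable_ker (p : L →ₗ⁅k⁆ g) (hp : Function.Surjective p)
    [IsSolvable p.ker] : ∃ s : g →ₗ⁅k⁆ L, ∀ y, p (s y) = y :=
  exists_section_of_finrank_eq _ L rfl p hp inferInstance

end Levi

/-- `nilpotencyLength` is defined through the lower central series over `ℤ`, whose terms have the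
same elements as those over `k`. -/
theorem LieModule.nilpotencyLength_eq_sInf (k L : Type*) [CommRing k] [LieRing L]
    [LieAlgebra k L] : nilpotencyLength L L = sInf {j | lowerCentralSeries k L L j = ⊥} := by
  unfold nilpotencyLength
  congr 1
  ext j
  simp [SetLike.ext'_iff, coe_lowerCentralSeries_eq_int k L L]

/-! ### Characteristically nilpotent algebras -/

namespace CharNilp

section CharNilpotent

variable {k : Type u} [Field k] {𝔫 : Type v} [LieRing 𝔫] [LieAlgebra k 𝔫]

theorem derivation_mem_derivedIdeal (D : LieDerivation k 𝔫 𝔫) {a : 𝔫}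
    (ha : a ∈ derivedIdeal k 𝔫) : D a ∈ derivedIdeal k 𝔫 := by
  have h : LieSubmodule.toSubmodule (derivedIdeal k 𝔫) ≤ (LieSubmodule.toSubmodule <| derivedIdeal k 𝔫).comap D.toLinearMap := by
    conv_lhs => rw [derivedIdeal, LieSubmodule.lieIdeal_oper_eq_linear_span']
    rw [Submodule.span_le]
    rintro _ ⟨a, -, b, -, rfl⟩
    change D ⁅a, b⁆ ∈ derivedIdeal k 𝔫
    rw [LieDerivation.apply_lie_eq_add]
    exact add_mem (LieSubmodule.lie_mem_lie (LieSubmodule.mem_top _) (LieSubmodule.mem_top _))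
      (LieSubmodule.lie_mem_lie (LieSubmodule.mem_top _) (LieSubmodule.mem_top _))
  exact h ha

/-- This is all that is used of characteristic nilpotency; applied to inner derivations it gives
nilpotency by Engel's theorem. -/
theorem IsCharNilpotent.exists_pow_eq_zero (h : IsCharNilpotent k 𝔫) :
    ∃ s : ℕ, ∀ D : LieDerivation k 𝔫 𝔫, D.toLinearMap ^ s = 0 := by
  obtain ⟨s, -, hs⟩ := h
  refine ⟨s, fun D => LinearMap.ext fun a => ?_⟩
  have : ∀ i, (D.toLinearMap ^ i) a ∈ derSeries k 𝔫 i := by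
    intro i
    induction i with
    | zero => trivial
    | succ i ih =>
      rw [pow_succ']
      exact Submodule.subset_span ⟨D, _, ih, rfl⟩
  have h0 := this s
  rw [hs] at h0
  exact h0

theorem IsCharNilpotent.isNilpotent [FiniteDimensional k 𝔫] (h : IsCharNilpotent k 𝔫) :
    LieRing.IsNilpotent 𝔫 := by
  rw [LieAlgebra.isNilpotent_iff_forall (R := k)]
  intro a
  obtain ⟨s, hs⟩ := h.exists_pow_eq_zero
  have := hs (LieDerivation.ad k 𝔫 a)
  refine ⟨s, ?_⟩
  rw [← this, LieDerivation.coe_ad_apply_eq_ad_apply]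

end CharNilpotent

/-! ### Block operators and the lower central series of `ℒ_n` -/

namespace GluedAlgebra

variable {k : Type u} [Field k] {𝔫 : Type v} [LieRing 𝔫] [LieAlgebra k 𝔫]
  {V : Type w} [AddCommGroup V] [Module k V] {n : ℕ}
  (z₀ : LieAlgebra.center k 𝔫) (e : Module.Basis (Fin n ⊕ Fin n) k V)

/-- The component in `𝔫`, as a linear map. -/
noncomputable def algL : GluedAlgebra z₀ e →ₗ[k] 𝔫 where
  toFun p := p.alg
  map_add' _ _ := rfl
  map_smul' _ _ := rfl

/-- The component in `V_n`, as a linear map. -/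
noncomputable def vecL : GluedAlgebra z₀ e →ₗ[k] V where
  toFun p := p.vec
  map_add' _ _ := rfl
  map_smul' _ _ := rfl

@[simp] theorem algL_apply (p : GluedAlgebra z₀ e) : algL z₀ e p = p.alg := rfl

@[simp] theorem vecL_apply (p : GluedAlgebra z₀ e) : vecL z₀ e p = p.vec := rfl

variable {z₀ e}

@[simp] theorem sub_alg (p q : GluedAlgebra z₀ e) : (p - q).alg = p.alg - q.alg :=
  map_sub (algL z₀ e) p q

@[simp] theorem sub_vec (p q : GluedAlgebra z₀ e) : (p - q).vec = p.vec - q.vec :=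
  map_sub (vecL z₀ e) p q

theorem eq_ofAlg_add_ofVec (p : GluedAlgebra z₀ e) :
    p = ofAlg z₀ e p.alg + ofVec z₀ e p.vec := by
  ext <;> simp

theorem finiteDimensional [FiniteDimensional k 𝔫] : FiniteDimensional k (GluedAlgebra z₀ e) := by
  have : FiniteDimensional k V := Module.Finite.of_basis e
  refine Module.Finite.of_injective ((algL z₀ e).prod (vecL z₀ e)) fun p q h => ?_
  have h' : (p.alg, p.vec) = (q.alg, q.vec) := h
  rw [Prod.mk.injEq] at h'
  exact GluedAlgebra.ext h'.1 h'.2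

variable (z₀ e)

/-- The endomorphism of `ℒ_n(𝔫, z₀)` with given components. -/
noncomputable def blocks (α : 𝔫 →ₗ[k] 𝔫) (β : 𝔫 →ₗ[k] V) (γ : V →ₗ[k] 𝔫) (f : V →ₗ[k] V) :
    End k (GluedAlgebra z₀ e) :=
  ((ofAlg z₀ e : 𝔫 →ₗ[k] GluedAlgebra z₀ e) ∘ₗ α + ofVec z₀ e ∘ₗ β) ∘ₗ algL z₀ e +
    ((ofAlg z₀ e : 𝔫 →ₗ[k] GluedAlgebra z₀ e) ∘ₗ γ + ofVec z₀ e ∘ₗ f) ∘ₗ vecL z₀ e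

variable {z₀ e}

@[simp] theorem blocks_apply_alg (α : 𝔫 →ₗ[k] 𝔫) (β : 𝔫 →ₗ[k] V) (γ : V →ₗ[k] 𝔫)
    (f : V →ₗ[k] V) (p : GluedAlgebra z₀ e) :
    (blocks z₀ e α β γ f p).alg = α p.alg + γ p.vec := by
  simp [blocks]

@[simp] theorem blocks_apply_vec (α : 𝔫 →ₗ[k] 𝔫) (β : 𝔫 →ₗ[k] V) (γ : V →ₗ[k] 𝔫)
    (f : V →ₗ[k] V) (p : GluedAlgebra z₀ e) :
    (blocks z₀ e α β γ f p).vec = β p.alg + f p.vec := by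
  simp [blocks]

theorem mem_der {δ : End k (GluedAlgebra z₀ e)} :
    δ ∈ der z₀ e ↔ ∀ p q, δ ⁅p, q⁆ = ⁅p, δ q⁆ + ⁅δ p, q⁆ := by
  constructor
  · rintro ⟨D, rfl⟩ p q
    exact D.apply_lie_eq_add p q
  · intro h
    refine ⟨⟨δ, fun p q => ?_⟩, rfl⟩
    rw [h, sub_eq_add_neg, lie_skew]

theorem sympForm_skew (u v : V) : sympForm e u v = -sympForm e v u := by
  have := sympForm_self e (u + v)
  simp only [map_add, LinearMap.add_apply, sympForm_self, zero_add, add_zero] at this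
  exact eq_neg_of_add_eq_zero_left (by rw [add_comm]; exact this)

theorem mem_skewAdjoint {f : End k V} :
    f ∈ skewAdjointLieSubalgebra (sympForm e) ↔
      ∀ u v, sympForm e (f u) v = -sympForm e u (f v) := by
  change f ∈ LinearMap.skewAdjointSubmodule (sympForm e) ↔ _
  rw [LinearMap.mem_skewAdjointSubmodule]
  refine forall₂_congr fun u v => ?_
  simp

section Center

variable (h_center : ∀ a : 𝔫, (∀ c : 𝔫, ⁅a, c⁆ ∈ LieAlgebra.center k 𝔫) → a ∈ derivedIdeal k 𝔫)

include h_center in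
theorem center_mem_derivedIdeal : (z₀ : 𝔫) ∈ derivedIdeal k 𝔫 :=
  h_center _ fun c => by rw [center_lie]; exact zero_mem _

include h_center in
-- The brackets of `V` add only multiples of `z₀`, which lies in `𝔫²` already; later commutators no
-- longer see `V`. Index `0` is excluded because `V` itself lives there.
theorem mem_lowerCentralSeries_succ (j : ℕ) (p : GluedAlgebra z₀ e) :
    p ∈ lowerCentralSeries k (GluedAlgebra z₀ e) (GluedAlgebra z₀ e) (j + 1) ↔
      p.vec = 0 ∧ p.alg ∈ lowerCentralSeries k 𝔫 𝔫 (j + 1) := by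
  constructor
  · let K : ℕ → LieIdeal k (GluedAlgebra z₀ e) := fun j =>
      { carrier := {p | p.vec = 0 ∧ p.alg ∈ lowerCentralSeries k 𝔫 𝔫 (j + 1)}
        zero_mem' := ⟨rfl, zero_mem _⟩
        add_mem' := fun {p q} hp hq => ⟨by simp [hp.1, hq.1], add_mem hp.2 hq.2⟩
        smul_mem' := fun c p hp => ⟨by simp [hp.1], Submodule.smul_mem _ c hp.2⟩
        lie_mem := fun {p q} hq => ⟨rfl, by
          simpa [hq.1] using LieSubmodule.lie_mem _ hq.2⟩ }
    suffices lowerCentralSeries k (GluedAlgebra z₀ e) (GluedAlgebra z₀ e) (j + 1) ≤ K j from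
      fun h => this h
    induction j with
    | zero =>
      rw [lowerCentralSeries_succ, LieSubmodule.lie_le_iff]
      intro p _ q _
      refine ⟨rfl, add_mem (LieSubmodule.lie_mem_lie (LieSubmodule.mem_top _)
        (LieSubmodule.mem_top _)) (Submodule.smul_mem _ _ ?_)⟩
      exact center_mem_derivedIdeal h_center
    | succ j ih =>
      rw [lowerCentralSeries_succ, LieSubmodule.lie_le_iff]
      intro p _ q hq
      have hq' := ih hq
      refine ⟨rfl, ?_⟩
      have h0 : q.vec = 0 := hq'.1
      rw [lie_alg, h0, map_zero, zero_smul, add_zero, lowerCentralSeries_succ]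
      exact LieSubmodule.lie_mem_lie (LieSubmodule.mem_top _) hq'.2
  · rintro ⟨h1, h2⟩
    have h3 : p = ofAlg z₀ e p.alg := by
      conv_lhs => rw [eq_ofAlg_add_ofVec p, h1, map_zero, add_zero]
    rw [h3]
    exact LieIdeal.map_lowerCentralSeries_le (R := k) (j + 1) (f := ofAlg z₀ e)
      (LieIdeal.mem_map h2)

include h_center in
theorem lowerCentralSeries_eq_bot_iff (hz₀ : z₀ ≠ 0) (j : ℕ) :
    lowerCentralSeries k (GluedAlgebra z₀ e) (GluedAlgebra z₀ e) j = ⊥ ↔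
      lowerCentralSeries k 𝔫 𝔫 j = ⊥ := by
  have hz : (z₀ : 𝔫) ≠ 0 := fun h => hz₀ (Subtype.ext h)
  cases j with
  | zero =>
    refine iff_of_false (fun h => ?_) (fun h => ?_)
    · have : ofAlg z₀ e (z₀ : 𝔫) ∈
          lowerCentralSeries k (GluedAlgebra z₀ e) (GluedAlgebra z₀ e) 0 := by simp
      rw [h] at this
      have h0 : ofAlg z₀ e (z₀ : 𝔫) = 0 := this
      exact hz (congrArg alg h0)
    · have : (z₀ : 𝔫) ∈ lowerCentralSeries k 𝔫 𝔫 0 := by simp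
      rw [h] at this
      exact hz this
  | succ j =>
    rw [LieSubmodule.eq_bot_iff, LieSubmodule.eq_bot_iff]
    constructor
    · intro h a ha
      exact congrArg alg (h (ofAlg z₀ e a) ((mem_lowerCentralSeries_succ h_center j _).2 ⟨rfl, ha⟩))
    · intro h p hp
      obtain ⟨h1, h2⟩ := (mem_lowerCentralSeries_succ h_center j _).1 hp
      exact GluedAlgebra.ext (h _ h2) h1

include h_center in
theorem nilpotencyLength_eq (hz₀ : z₀ ≠ 0) :
    LieModule.nilpotencyLength (GluedAlgebra z₀ e) (GluedAlgebra z₀ e) =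
      LieModule.nilpotencyLength 𝔫 𝔫 := by
  rw [nilpotencyLength_eq_sInf k 𝔫, nilpotencyLength_eq_sInf k (GluedAlgebra z₀ e)]
  congr 1
  ext j
  exact lowerCentralSeries_eq_bot_iff h_center hz₀ j

include h_center in
theorem isNilpotent_of_isNilpotent (hz₀ : z₀ ≠ 0) (h : LieRing.IsNilpotent 𝔫) :
    LieRing.IsNilpotent (GluedAlgebra z₀ e) := by
  obtain ⟨j, hj⟩ := LieModule.IsNilpotent.nilpotent k 𝔫 𝔫
  exact (LieModule.isNilpotent_iff k _ _).2
    ⟨j, (lowerCentralSeries_eq_bot_iff h_center hz₀ j).2 hj⟩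

end Center

end GluedAlgebra

end CharNilp

/-! ### The derivation algebra of `ℒ_n` -/

namespace CharNilp.GluedAlgebra

variable {k : Type u} [Field k] {𝔫 : Type v} [LieRing 𝔫] [LieAlgebra k 𝔫]
  {V : Type w} [AddCommGroup V] [Module k V] {n : ℕ}
  {z₀ : LieAlgebra.center k 𝔫} {e : Module.Basis (Fin n ⊕ Fin n) k V}

theorem vec_apply_ofVec_of_mem_nilPart {δ : End k (GluedAlgebra z₀ e)} (h : δ ∈ nilPart z₀ e)
    (u : V) : (δ (ofVec z₀ e u)).vec = 0 := by
  obtain ⟨ε, hε, η, hη, rfl⟩ := Submodule.mem_sup.1 h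
  obtain ⟨c, -, hc⟩ := hη.1 u
  simp [hε.1 u, hc]

theorem disjoint_nilEven_nilOdd : Disjoint (nilEven z₀ e) (nilOdd z₀ e) := by
  rw [Submodule.disjoint_def]
  rintro δ ⟨h1, ⟨D, hD⟩, -⟩ ⟨-, h2, -⟩
  refine LinearMap.ext fun p => ?_
  obtain ⟨v, hv⟩ := h2 p.alg
  have h3 : δ (ofAlg z₀ e p.alg) = 0 := by
    ext
    · rw [hv]; rfl
    · rw [hD]; rfl
  rw [eq_ofAlg_add_ofVec p, map_add, h1, h3, add_zero, LinearMap.zero_apply]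

theorem disjoint_spStar_nilPart : Disjoint (spStar z₀ e).toSubmodule (nilPart z₀ e) := by
  rw [Submodule.disjoint_def]
  rintro δ ⟨⟨f, -, hf⟩, h1⟩ h2
  refine LinearMap.ext fun p => ?_
  have h3 : δ (ofVec z₀ e p.vec) = 0 := by
    ext
    · rw [hf]; rfl
    · exact vec_apply_ofVec_of_mem_nilPart h2 _
  rw [eq_ofAlg_add_ofVec p, map_add, h1, h3, add_zero, LinearMap.zero_apply]

theorem spStar_le_der : (spStar z₀ e).toSubmodule ≤ (der z₀ e).toSubmodule := by
  rintro δ ⟨⟨f, hf, hδ⟩, h1⟩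
  refine mem_der.2 fun p q => ?_
  have hp : ∀ p, δ p = ofVec z₀ e (f p.vec) := fun p => by
    rw [eq_ofAlg_add_ofVec p, map_add, h1, hδ]; simp
  rw [hp, hp, hp]
  ext
  · simp [(mem_skewAdjoint.1 hf) p.vec q.vec]
  · simp

theorem nilEven_le_der : nilEven z₀ e ≤ (der z₀ e).toSubmodule := by
  rintro δ ⟨h1, ⟨D, hD⟩, h2⟩
  refine mem_der.2 fun p q => ?_
  have hp : ∀ p, δ p = ofAlg z₀ e (D p.alg) := fun p => by
    rw [eq_ofAlg_add_ofVec p, map_add, h1, hD]; simp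
  have hz : D (z₀ : 𝔫) = 0 := by
    have := congrArg alg ((hD z₀).symm.trans h2)
    exact this
  rw [hp, hp, hp]
  ext
  · simp [-LieDerivation.apply_lie_eq_sub, LieDerivation.apply_lie_eq_add, hz]
  · simp

section

variable (h_center : ∀ a : 𝔫, (∀ c : 𝔫, ⁅a, c⁆ ∈ LieAlgebra.center k 𝔫) → a ∈ derivedIdeal k 𝔫)

theorem lie_mem_derivedIdeal (a b : 𝔫) : ⁅a, b⁆ ∈ derivedIdeal k 𝔫 :=
  LieSubmodule.lie_mem_lie (LieSubmodule.mem_top _) (LieSubmodule.mem_top _)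

include h_center in
theorem nilOdd_le_der : nilOdd z₀ e ≤ (der z₀ e).toSubmodule := by
  rintro δ ⟨h1, h2, h3, h4⟩
  refine mem_der.2 fun p q => ?_
  obtain ⟨c, hc, hδp⟩ := h1 p.vec
  obtain ⟨d, hd, hδq⟩ := h1 q.vec
  obtain ⟨u, hu⟩ := h2 p.alg
  obtain ⟨v, hv⟩ := h2 q.alg
  have h5 := congrArg alg (h4 p.vec q.alg)
  have h6 := congrArg alg (h4 q.vec p.alg)
  have hp : δ p = ofAlg z₀ e c + ofVec z₀ e u := by
    conv_lhs => rw [eq_ofAlg_add_ofVec p, map_add, hu, hδp, add_comm]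
  have hq : δ q = ofAlg z₀ e d + ofVec z₀ e v := by
    conv_lhs => rw [eq_ofAlg_add_ofVec q, map_add, hv, hδq, add_comm]
  have hpq : δ ⁅p, q⁆ = 0 := by
    have : ⁅p, q⁆ = ofAlg z₀ e ⁅p, q⁆.alg := by ext <;> simp
    rw [this]
    refine h3 _ (add_mem (lie_mem_derivedIdeal _ _) (Submodule.smul_mem _ _ ?_))
    exact center_mem_derivedIdeal h_center
  rw [hδp, hv] at h5
  rw [hδq, hu] at h6
  simp at h5 h6
  rw [hpq, hp, hq]
  ext
  · have h7 : ⁅p.alg, d⁆ = sympForm e q.vec u • (z₀ : 𝔫) := by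
      rw [← lie_skew, h6, neg_neg]
    simp [h5, h7, sympForm_skew u q.vec]
  · simp

/-- The component in `𝔫` of a derivation of `ℒ_n(𝔫, z₀)`, restricted to `𝔫`. -/
noncomputable def restrictDer (δ : End k (GluedAlgebra z₀ e)) (hδ : δ ∈ der z₀ e) :
    LieDerivation k 𝔫 𝔫 where
  toLinearMap := algL z₀ e ∘ₗ δ ∘ₗ (ofAlg z₀ e : 𝔫 →ₗ[k] GluedAlgebra z₀ e)
  leibniz' a b := by
    have := congrArg alg (mem_der.1 hδ (ofAlg z₀ e a) (ofAlg z₀ e b))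
    rw [← LieHom.map_lie] at this
    rw [sub_eq_add_neg, lie_skew]
    simpa using this

@[simp] theorem restrictDer_apply {δ : End k (GluedAlgebra z₀ e)} (hδ : δ ∈ der z₀ e) (a : 𝔫) :
    restrictDer δ hδ a = (δ (ofAlg z₀ e a)).alg := rfl

theorem vec_apply_ofAlg_eq_zero {δ : End k (GluedAlgebra z₀ e)} (hδ : δ ∈ der z₀ e) {a : 𝔫}
    (ha : a ∈ derivedIdeal k 𝔫) : (δ (ofAlg z₀ e a)).vec = 0 := by
  have h : LieSubmodule.toSubmodule (derivedIdeal k 𝔫) ≤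
      LinearMap.ker (vecL z₀ e ∘ₗ δ ∘ₗ (ofAlg z₀ e : 𝔫 →ₗ[k] GluedAlgebra z₀ e)) := by
    conv_lhs => rw [derivedIdeal, LieSubmodule.lieIdeal_oper_eq_linear_span']
    rw [Submodule.span_le]
    rintro _ ⟨a, -, b, -, rfl⟩
    change (δ (ofAlg z₀ e ⁅a, b⁆)).vec = 0
    rw [LieHom.map_lie, mem_der.1 hδ]
    simp
  exact h ha

theorem lie_alg_apply_ofVec {δ : End k (GluedAlgebra z₀ e)} (hδ : δ ∈ der z₀ e) (u : V) (a : 𝔫) :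
    ⁅(δ (ofVec z₀ e u)).alg, a⁆ =
      -(sympForm e u (δ (ofAlg z₀ e a)).vec • (z₀ : 𝔫)) := by
  have := congrArg alg (mem_der.1 hδ (ofVec z₀ e u) (ofAlg z₀ e a))
  rw [lie_ofVec_ofAlg, map_zero] at this
  simp at this
  exact (neg_eq_of_add_eq_zero_right this.symm).symm

include h_center in
theorem alg_apply_ofVec_mem {δ : End k (GluedAlgebra z₀ e)} (hδ : δ ∈ der z₀ e) (u : V) :
    (δ (ofVec z₀ e u)).alg ∈ derivedIdeal k 𝔫 := by
  refine h_center _ fun a => ?_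
  rw [lie_alg_apply_ofVec hδ]
  exact neg_mem (Submodule.smul_mem _ _ z₀.2)

include h_center in
theorem alg_apply_mem {δ : End k (GluedAlgebra z₀ e)} (hδ : δ ∈ der z₀ e)
    {p : GluedAlgebra z₀ e} (hp : p.alg ∈ derivedIdeal k 𝔫) :
    (δ p).alg ∈ derivedIdeal k 𝔫 := by
  rw [eq_ofAlg_add_ofVec p, map_add, add_alg]
  exact add_mem (derivation_mem_derivedIdeal (restrictDer δ hδ) hp)
    (alg_apply_ofVec_mem h_center hδ _)

theorem vec_apply_eq {δ : End k (GluedAlgebra z₀ e)} (hδ : δ ∈ der z₀ e)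
    {p : GluedAlgebra z₀ e} (hp : p.alg ∈ derivedIdeal k 𝔫) :
    (δ p).vec = (δ (ofVec z₀ e p.vec)).vec := by
  conv_lhs => rw [eq_ofAlg_add_ofVec p, map_add, add_vec, vec_apply_ofAlg_eq_zero hδ hp, zero_add]

theorem apply_center_eq {δ : End k (GluedAlgebra z₀ e)} (hδ : δ ∈ der z₀ e) (u v : V) :
    sympForm e u v • δ (ofAlg z₀ e (z₀ : 𝔫)) =
      (sympForm e u (δ (ofVec z₀ e v)).vec + sympForm e (δ (ofVec z₀ e u)).vec v) •
        ofAlg z₀ e (z₀ : 𝔫) := by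
  have := mem_der.1 hδ (ofVec z₀ e u) (ofVec z₀ e v)
  rw [lie_ofVec_ofVec, map_smul] at this
  rw [this]
  ext
  · simp [add_smul]
  · simp

include h_center in
-- Modulo `𝔫² + V` a derivation acts through its block `α`, because `γ(V) ⊆ 𝔫²`.
theorem pow_apply_alg_sub_mem {δ : End k (GluedAlgebra z₀ e)} (hδ : δ ∈ der z₀ e) (j : ℕ)
    (p : GluedAlgebra z₀ e) :
    ((δ ^ j) p).alg - ((restrictDer δ hδ).toLinearMap ^ j) p.alg ∈ derivedIdeal k 𝔫 := by
  induction j with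
  | zero => simp
  | succ j ih =>
    rw [pow_succ', pow_succ', Module.End.mul_apply, Module.End.mul_apply]
    have h3 := derivation_mem_derivedIdeal (restrictDer δ hδ) ih
    rw [map_sub] at h3
    have h2 : (δ ((δ ^ j) p)).alg =
        restrictDer δ hδ ((δ ^ j) p).alg + (δ (ofVec z₀ e ((δ ^ j) p).vec)).alg := by
      conv_lhs => rw [eq_ofAlg_add_ofVec ((δ ^ j) p), map_add, add_alg]
      rfl
    rw [h2, add_sub_right_comm]
    exact add_mem h3 (alg_apply_ofVec_mem h_center hδ _)

theorem pow_apply_ofAlg {δ : End k (GluedAlgebra z₀ e)} (hδ : δ ∈ der z₀ e) (j : ℕ) {c : 𝔫}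
    (hc : c ∈ derivedIdeal k 𝔫) :
    ((restrictDer δ hδ).toLinearMap ^ j) c ∈ derivedIdeal k 𝔫 ∧
      (δ ^ j) (ofAlg z₀ e c) = ofAlg z₀ e (((restrictDer δ hδ).toLinearMap ^ j) c) := by
  induction j with
  | zero => exact ⟨hc, rfl⟩
  | succ j ih =>
    rw [pow_succ', pow_succ', Module.End.mul_apply, Module.End.mul_apply, ih.2]
    refine ⟨derivation_mem_derivedIdeal _ ih.1, ?_⟩
    ext
    · rfl
    · exact vec_apply_ofAlg_eq_zero hδ ih.1

section Nilpotent

variable {s : ℕ} (hs : ∀ D : LieDerivation k 𝔫 𝔫, D.toLinearMap ^ s = 0) (hz₀ : z₀ ≠ 0)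
  (hn : 1 ≤ n)

include h_center hs hz₀ hn

omit h_center in
theorem apply_center_eq_zero {δ : End k (GluedAlgebra z₀ e)} (hδ : δ ∈ der z₀ e) :
    δ (ofAlg z₀ e (z₀ : 𝔫)) = 0 := by
  have hz : (z₀ : 𝔫) ≠ 0 := fun h => hz₀ (Subtype.ext h)
  -- The pair `x_1, y_1`, available since `n ≥ 1`, has `b = 1`, so `z₀` is an eigenvector; its
  -- eigenvalue `c` satisfies `c ^ s = 0`.
  have h := apply_center_eq hδ (e (Sum.inl ⟨0, hn⟩)) (e (Sum.inr ⟨0, hn⟩))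
  rw [sympForm_inl_inr, if_pos rfl, one_smul] at h
  generalize sympForm e (e (Sum.inl ⟨0, hn⟩)) (δ (ofVec z₀ e (e (Sum.inr ⟨0, hn⟩)))).vec +
    sympForm e (δ (ofVec z₀ e (e (Sum.inl ⟨0, hn⟩)))).vec (e (Sum.inr ⟨0, hn⟩)) = c at h
  have h1 : ∀ j : ℕ, ((restrictDer δ hδ).toLinearMap ^ j) (z₀ : 𝔫) = c ^ j • (z₀ : 𝔫) := by
    intro j
    induction j with
    | zero => simp
    | succ j ih =>
      rw [pow_succ', Module.End.mul_apply, ih, map_smul]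
      change c ^ j • (δ (ofAlg z₀ e (z₀ : 𝔫))).alg = _
      rw [h, smul_alg, ofAlg_alg, smul_smul, pow_succ]
  have h2 := h1 s
  rw [hs, LinearMap.zero_apply, eq_comm, smul_eq_zero, or_iff_left hz] at h2
  rw [h, eq_zero_of_pow_eq_zero h2, zero_smul]

omit h_center in
theorem skew_of_mem_der {δ : End k (GluedAlgebra z₀ e)} (hδ : δ ∈ der z₀ e) :
    vecL z₀ e ∘ₗ δ ∘ₗ ofVec z₀ e ∈ skewAdjointLieSubalgebra (sympForm e) := by
  have hz : (z₀ : 𝔫) ≠ 0 := fun h => hz₀ (Subtype.ext h)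
  rw [mem_skewAdjoint]
  intro u v
  have h := congrArg alg (apply_center_eq hδ u v)
  rw [apply_center_eq_zero hs hz₀ hn hδ, smul_zero, smul_alg, ofAlg_alg, zero_alg,
    eq_comm, smul_eq_zero, or_iff_left hz] at h
  exact eq_neg_of_add_eq_zero_right h

/-- The summands are the blocks `f`, `α` and `(β, γ)`. The last clause records that `σ` carries the
block `f` of `δ`, which later identifies `𝔑` as the derivations with `f = 0`. -/
theorem mem_spStar_sup_nilPart {δ : End k (GluedAlgebra z₀ e)} (hδ : δ ∈ der z₀ e) :
    ∃ σ ∈ spStar z₀ e, ∃ ν ∈ nilPart z₀ e, δ = σ + ν ∧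
      ∀ u, σ (ofVec z₀ e u) = ofVec z₀ e (δ (ofVec z₀ e u)).vec := by
  let α : 𝔫 →ₗ[k] 𝔫 := (restrictDer δ hδ).toLinearMap
  let β : 𝔫 →ₗ[k] V := vecL z₀ e ∘ₗ δ ∘ₗ (ofAlg z₀ e : 𝔫 →ₗ[k] GluedAlgebra z₀ e)
  let γ : V →ₗ[k] 𝔫 := algL z₀ e ∘ₗ δ ∘ₗ ofVec z₀ e
  let f : V →ₗ[k] V := vecL z₀ e ∘ₗ δ ∘ₗ ofVec z₀ e
  refine ⟨blocks z₀ e 0 0 0 f, ⟨⟨f, skew_of_mem_der hs hz₀ hn hδ, fun u => ?_⟩,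
    fun a => ?_⟩, blocks z₀ e α 0 0 0 + blocks z₀ e 0 β γ 0, Submodule.add_mem_sup
      ⟨fun u => ?_, ⟨restrictDer δ hδ, fun a => ?_⟩, ?_⟩
      ⟨fun u => ⟨γ u, alg_apply_ofVec_mem h_center hδ u, ?_⟩, fun a => ⟨β a, ?_⟩, fun a ha => ?_,
        fun u a => ?_⟩, ?_, fun u => ?_⟩
  · ext <;> simp
  · ext <;> simp
  · ext <;> simp
  · ext <;> simp [α]
  · ext
    · simpa [α] using congrArg alg (apply_center_eq_zero hs hz₀ hn hδ)
    · simp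
  · ext <;> simp
  · ext <;> simp
  · ext
    · simp
    · simpa [β] using vec_apply_ofAlg_eq_zero hδ ha
  · ext
    · simpa [β, γ] using lie_alg_apply_ofVec hδ u a
    · simp
  · refine LinearMap.ext fun p => ?_
    conv_lhs => rw [eq_ofAlg_add_ofVec p, map_add]
    ext
    · simp [α, γ]
    · simp [β, f, add_comm]
  · ext <;> simp [f]

theorem mem_nilPart_iff {δ : End k (GluedAlgebra z₀ e)} :
    δ ∈ nilPart z₀ e ↔ δ ∈ der z₀ e ∧ ∀ u, (δ (ofVec z₀ e u)).vec = 0 := by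
  constructor
  · exact fun h => ⟨sup_le nilEven_le_der (nilOdd_le_der h_center) h,
      vec_apply_ofVec_of_mem_nilPart h⟩
  · rintro ⟨hδ, h⟩
    obtain ⟨σ, hσ, ν, hν, rfl, h1⟩ := mem_spStar_sup_nilPart h_center hs hz₀ hn hδ
    have : σ = 0 := by
      refine LinearMap.ext fun p => ?_
      rw [eq_ofAlg_add_ofVec p, map_add, hσ.2, h1, h, map_zero, add_zero, LinearMap.zero_apply]
    rwa [this, zero_add]

theorem der_eq_spStar_sup_nilPart :
    (der z₀ e).toSubmodule = (spStar z₀ e).toSubmodule ⊔ nilPart z₀ e := by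
  refine le_antisymm (fun δ hδ => ?_)
    (sup_le spStar_le_der (sup_le nilEven_le_der (nilOdd_le_der h_center)))
  obtain ⟨σ, hσ, ν, hν, rfl, -⟩ := mem_spStar_sup_nilPart h_center hs hz₀ hn hδ
  exact Submodule.add_mem_sup hσ hν

omit hz₀ hn in
theorem isNilpotent_of_mem_nilPart {δ : End k (GluedAlgebra z₀ e)} (h : δ ∈ nilPart z₀ e) :
    _root_.IsNilpotent δ := by
  have hδ : δ ∈ der z₀ e := sup_le nilEven_le_der (nilOdd_le_der h_center) h
  have hf := vec_apply_ofVec_of_mem_nilPart h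
  -- The first `s` applications lead into `𝔫² + V`, one more into `𝔫²` because `f = 0`, and the last
  -- `s` kill `𝔫²`.
  refine ⟨s + (1 + s), LinearMap.ext fun p => ?_⟩
  have h3 := pow_apply_alg_sub_mem h_center hδ s p
  rw [hs, LinearMap.zero_apply, sub_zero] at h3
  have h4 := alg_apply_mem h_center hδ h3
  have h5 : δ ((δ ^ s) p) = ofAlg z₀ e (δ ((δ ^ s) p)).alg := by
    ext
    · rfl
    · rw [vec_apply_eq hδ h3, hf]; rfl
  rw [pow_add, pow_add, pow_one, Module.End.mul_apply, Module.End.mul_apply, LinearMap.zero_apply]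
  refine (congrArg (δ ^ s) h5).trans ?_
  rw [(pow_apply_ofAlg hδ s h4).2, hs, LinearMap.zero_apply, map_zero]

/-- The ideal `𝔑` of `Der ℒ_n(𝔫, z₀)`. -/
noncomputable def nilIdeal : LieIdeal k (der z₀ e) where
  __ := (nilPart z₀ e).comap (der z₀ e).toSubmodule.subtype
  lie_mem := by
    rintro ⟨δ, hδ⟩ ⟨ν, hν'⟩ hν
    change ⁅δ, ν⁆ ∈ nilPart z₀ e
    replace hν : ν ∈ nilPart z₀ e := hν
    rw [mem_nilPart_iff h_center hs hz₀ hn] at hν ⊢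
    refine ⟨(der z₀ e).lie_mem hδ hν.1, fun u => ?_⟩
    -- Since `β` kills `𝔫²` and `γ` takes values there, the block `f` of a product of two
    -- derivations is the product of their blocks `f`.
    rw [Ring.lie_def, LinearMap.sub_apply, sub_vec, Module.End.mul_apply, Module.End.mul_apply,
      vec_apply_eq hδ (alg_apply_ofVec_mem h_center hν.1 u), hν.2,
      vec_apply_eq hν.1 (alg_apply_ofVec_mem h_center hδ u), hν.2]
    simp

theorem map_nilIdeal : (nilIdeal (e := e) h_center hs hz₀ hn).toSubmodule.map
    (der z₀ e).toSubmodule.subtype = nilPart z₀ e :=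
  (Submodule.map_comap_subtype _ _).trans
    (inf_eq_right.2 (sup_le nilEven_le_der (nilOdd_le_der h_center)))

theorem isNilpotent_nilIdeal [FiniteDimensional k 𝔫] :
    LieRing.IsNilpotent (nilIdeal (e := e) h_center hs hz₀ hn) := by
  have : FiniteDimensional k (GluedAlgebra z₀ e) := finiteDimensional
  refine LieAlgebra.isNilpotent_of_injective_of_isNilpotent
    ((der z₀ e).incl.comp (nilIdeal (e := e) h_center hs hz₀ hn).incl) ?_ fun x => ?_
  · exact fun x y h => Subtype.ext (Subtype.ext h)
  · exact isNilpotent_of_mem_nilPart h_center hs x.2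

end Nilpotent

end

end CharNilp.GluedAlgebra

/-! ### Conjugating semisimple algebras of derivations into `𝔰𝔭(V_n, b)^⋆` -/

/-- A representation of a semisimple Lie algebra by nilpotent operators is trivial. -/
theorem LieModule.lie_eq_zero_of_forall_isNilpotent {k : Type*} [Field k] [CharZero k]
    {g : Type*} [LieRing g] [LieAlgebra k g] [FiniteDimensional k g] [HasTrivialRadical k g]
    {M : Type*} [AddCommGroup M] [Module k M] [FiniteDimensional k M] [LieRingModule g M]
    [LieModule k g M] (h : ∀ x : g, _root_.IsNilpotent (toEnd k g M x)) (x : g) (m : M) :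
    ⁅x, m⁆ = 0 := by
  have : LieModule.IsNilpotent g M := (LieModule.isNilpotent_iff_forall' (R := k)).2 h
  -- The trace form of a nilpotent module vanishes, yet it is nondegenerate on the Killing
  -- complement of the kernel.
  have hJ : (LieModule.ker k g M).killingCompl = ⊥ := by
    rw [LieSubmodule.eq_bot_iff]
    exact fun y hy => eq_zero_of_mem_killingCompl_ker hy fun z _ => by simp
  have hc := (LieModule.ker k g M).isCompl_killingCompl.sup_eq_top
  rw [hJ, sup_bot_eq] at hc
  have hx : x ∈ LieModule.ker k g M := by rw [hc]; trivial
  exact (LieModule.mem_ker k g M x).1 hx m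

namespace CharNilp.GluedAlgebra

variable {k : Type u} [Field k] {𝔫 : Type v} [LieRing 𝔫] [LieAlgebra k 𝔫]
  {V : Type w} [AddCommGroup V] [Module k V] {n : ℕ}
  {z₀ : LieAlgebra.center k 𝔫} {e : Module.Basis (Fin n ⊕ Fin n) k V}

section Exp

variable [CharZero k] {β : 𝔫 →ₗ[k] V} {γ : V →ₗ[k] 𝔫}
  (hγ : ∀ u, γ u ∈ derivedIdeal k 𝔫) (hβ : ∀ a ∈ derivedIdeal k 𝔫, β a = 0)
  (hβγ : ∀ u a, ⁅γ u, a⁆ = -(sympForm e u (β a) • (z₀ : 𝔫)))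

variable (z₀ e β γ) in
/-- The exponential of the element of `𝔑_1` with components `β` and `γ`. -/
noncomputable def expOdd : End k (GluedAlgebra z₀ e) :=
  -- When `β ∘ γ = 0`, the square of the odd operator is `γ ∘ β` on `𝔫` and zero on `V`, and its
  -- cube vanishes, so the exponential series stops here.
  blocks z₀ e (LinearMap.id + (2⁻¹ : k) • γ ∘ₗ β) β γ LinearMap.id

include hγ hβ in
theorem expOdd_neg_apply_expOdd (p : GluedAlgebra z₀ e) :
    expOdd z₀ e (-β) (-γ) (expOdd z₀ e β γ p) = p := by
  have h : ∀ u, β (γ u) = 0 := fun u => hβ _ (hγ u)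
  ext
  · simp [expOdd, h]
    module
  · simp [expOdd, h]

include hγ hβ hβγ in
theorem expOdd_lie (h_center : ∀ a : 𝔫,
      (∀ c : 𝔫, ⁅a, c⁆ ∈ LieAlgebra.center k 𝔫) → a ∈ derivedIdeal k 𝔫)
    (p q : GluedAlgebra z₀ e) :
    expOdd z₀ e β γ ⁅p, q⁆ = ⁅expOdd z₀ e β γ p, expOdd z₀ e β γ q⁆ := by
  have h : ∀ u, β (γ u) = 0 := fun u => hβ _ (hγ u)
  have h0 : β ⁅p, q⁆.alg = 0 := hβ _ (add_mem (lie_mem_derivedIdeal _ _)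
    (Submodule.smul_mem _ _ (center_mem_derivedIdeal h_center)))
  have h1 : ∀ a u, ⁅a, γ u⁆ = sympForm e u (β a) • (z₀ : 𝔫) := fun a u => by
    rw [← lie_skew, hβγ, neg_neg]
  have h2 : (2⁻¹ : k) + 2⁻¹ = 1 := by
    rw [← two_mul, mul_inv_cancel₀ two_ne_zero]
  ext
  · have e1 : (expOdd z₀ e β γ ⁅p, q⁆).alg = ⁅p, q⁆.alg := by
      simp only [expOdd, blocks_apply_alg, LinearMap.add_apply, LinearMap.smul_apply,
        LinearMap.comp_apply, h0]
      simp
    rw [e1]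
    simp only [expOdd, blocks_apply_alg, blocks_apply_vec, LinearMap.add_apply,
      LinearMap.smul_apply, LinearMap.comp_apply, lie_alg, LinearMap.id_apply, add_lie, lie_add,
      smul_lie, lie_smul, hβγ, h1, h, map_add, map_smul, map_zero, smul_zero]
    rw [sympForm_skew q.vec (β p.alg), sympForm_skew (β q.alg) (β p.alg)]
    match_scalars
    · ring
    · simp
      linear_combination (-sympForm e (β p.alg) (β q.alg)) * h2
  · simp only [expOdd, blocks_apply_vec, h0, lie_vec]
    simp

end Exp

section Conjugation

variable [CharZero k] [FiniteDimensional k 𝔫]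
  (h_center : ∀ a : 𝔫, (∀ c : 𝔫, ⁅a, c⁆ ∈ LieAlgebra.center k 𝔫) → a ∈ derivedIdeal k 𝔫)
  {s : ℕ} (hs : ∀ D : LieDerivation k 𝔫 𝔫, D.toLinearMap ^ s = 0)
  {g : Type*} [LieRing g] [LieAlgebra k g] [FiniteDimensional k g] [HasTrivialRadical k g]
  (ρ : g →ₗ⁅k⁆ End k (GluedAlgebra z₀ e)) (hρ : ∀ x, ρ x ∈ der z₀ e)

include h_center hs hρ

/-- On the quotient by `𝔫² + V` the algebra `g` acts by nilpotent operators, hence trivially. -/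
theorem alg_apply_mem_of_hasTrivialRadical (x : g) (p : GluedAlgebra z₀ e) :
    (ρ x p).alg ∈ derivedIdeal k 𝔫 := by
  have : FiniteDimensional k (GluedAlgebra z₀ e) := finiteDimensional
  let _ : LieRingModule g (GluedAlgebra z₀ e) := LieRingModule.compLieHom _ ρ
  have : LieModule k g (GluedAlgebra z₀ e) := LieModule.compLieHom _ ρ
  let W : LieSubmodule k g (GluedAlgebra z₀ e) :=
    { (derivedIdeal k 𝔫).toSubmodule.comap (algL z₀ e) with
      lie_mem := fun {x p} hp => alg_apply_mem h_center (hρ x) hp }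
  have : FiniteDimensional k (GluedAlgebra z₀ e ⧸ W) :=
    inferInstanceAs (FiniteDimensional k (GluedAlgebra z₀ e ⧸ W.toSubmodule))
  have h := lie_eq_zero_of_forall_isNilpotent (k := k) (g := g) (M := GluedAlgebra z₀ e ⧸ W)
    (fun x => ⟨s, LinearMap.ext fun q => by
      obtain ⟨q, rfl⟩ := LieSubmodule.Quotient.surjective_mk' W q
      have key : ∀ j, ((toEnd k g (GluedAlgebra z₀ e ⧸ W) x) ^ j)
          (LieSubmodule.Quotient.mk' W q) = LieSubmodule.Quotient.mk' W ((ρ x ^ j) q) := by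
        intro j
        induction j with
        | zero => rfl
        | succ j ih =>
          rw [pow_succ', pow_succ', Module.End.mul_apply, Module.End.mul_apply, ih]
          rfl
      rw [key, LinearMap.zero_apply, LieSubmodule.Quotient.mk_eq_zero]
      have := pow_apply_alg_sub_mem h_center (hρ x) s q
      rw [hs, LinearMap.zero_apply, sub_zero] at this
      exact this⟩)
  have h1 := h x (LieSubmodule.Quotient.mk' W p)
  rw [← LieModuleHom.map_lie, LieSubmodule.Quotient.mk_eq_zero] at h1
  exact h1

/-- The subspace `𝔫²` is stable, and `g` acts on it by nilpotent operators, hence trivially. -/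
theorem apply_ofAlg_eq_zero_of_hasTrivialRadical (x : g) {c : 𝔫} (hc : c ∈ derivedIdeal k 𝔫) :
    ρ x (ofAlg z₀ e c) = 0 := by
  have : FiniteDimensional k (GluedAlgebra z₀ e) := finiteDimensional
  let _ : LieRingModule g (GluedAlgebra z₀ e) := LieRingModule.compLieHom _ ρ
  have : LieModule k g (GluedAlgebra z₀ e) := LieModule.compLieHom _ ρ
  let N : LieSubmodule k g (GluedAlgebra z₀ e) :=
    { (derivedIdeal k 𝔫).toSubmodule.comap (algL z₀ e) ⊓ LinearMap.ker (vecL z₀ e) with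
      lie_mem := fun {x p} hp => by
        refine ⟨alg_apply_mem h_center (hρ x) hp.1, ?_⟩
        have hv : p.vec = 0 := hp.2
        change (ρ x p).vec = 0
        rw [vec_apply_eq (hρ x) hp.1, hv, map_zero, map_zero]
        rfl }
  have h := lie_eq_zero_of_forall_isNilpotent (k := k) (g := g) (M := N)
    (fun x => ⟨s, LinearMap.ext fun q => by
      have key : ∀ j, (((toEnd k g N x) ^ j) q : GluedAlgebra z₀ e) = (ρ x ^ j) q := by
        intro j
        induction j with
        | zero => rfl
        | succ j ih =>
          rw [pow_succ', pow_succ', Module.End.mul_apply, Module.End.mul_apply, ← ih]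
          rfl
      refine Subtype.ext ?_
      rw [key]
      have hq : (q : GluedAlgebra z₀ e) = ofAlg z₀ e q.1.alg := GluedAlgebra.ext rfl q.2.2
      rw [hq, (pow_apply_ofAlg (hρ x) s (c := q.1.alg) q.2.1).2, hs]
      rfl⟩)
  exact congrArg Subtype.val (h x ⟨ofAlg z₀ e c, hc, rfl⟩)

/-- A semisimple algebra of derivations acts, up to a perturbation by an element of `𝔑_1` with
components `β` and `γ`, through `𝔰𝔭(V_n, b)^⋆`. -/
theorem exists_odd_components (hz₀ : z₀ ≠ 0) (hn : 1 ≤ n) :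
    ∃ (β : 𝔫 →ₗ[k] V) (γ : V →ₗ[k] 𝔫), (∀ u, γ u ∈ derivedIdeal k 𝔫) ∧
      (∀ a ∈ derivedIdeal k 𝔫, β a = 0) ∧
      (∀ u a, ⁅γ u, a⁆ = -(sympForm e u (β a) • (z₀ : 𝔫))) ∧
      (∀ x u, (ρ x (ofVec z₀ e u)).alg = γ (ρ x (ofVec z₀ e u)).vec) ∧
      ∀ x a, ρ x (ofAlg z₀ e a + ofVec z₀ e (β a)) = 0 := by
  have hA := alg_apply_mem_of_hasTrivialRadical h_center hs ρ hρ
  have hB := fun x c => apply_ofAlg_eq_zero_of_hasTrivialRadical h_center hs ρ hρ x (c := c)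
  have hskew := fun x => mem_skewAdjoint.1 (skew_of_mem_der hs hz₀ hn (hρ x))
  have : FiniteDimensional k (GluedAlgebra z₀ e) := finiteDimensional
  let _ : LieRingModule g (GluedAlgebra z₀ e) := LieRingModule.compLieHom _ ρ
  have : LieModule k g (GluedAlgebra z₀ e) := LieModule.compLieHom _ ρ
  -- `ℒ_n = F ⊕ U`, with `F` the invariants and `U` the span of all `ρ x p`. Here `𝔫² ⊆ F` and `U ⊆
  -- 𝔫² + V`.
  have hcompl := isCompl_maxTrivSubmodule_lie_top (M := GluedAlgebra z₀ e)
    (LieHom.id : g →ₗ⁅k⁆ g) Function.surjective_id (fun x hx m => by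
      have hx' : x = 0 := hx
      rw [hx', zero_lie])
  rw [← LieSubmodule.isCompl_toSubmodule] at hcompl
  generalize hU : LieSubmodule.toSubmodule ⁅(⊤ : LieIdeal k g),
    (⊤ : LieSubmodule k g (GluedAlgebra z₀ e))⁆ = U at hcompl
  rw [LieSubmodule.lieIdeal_oper_eq_linear_span'] at hU
  obtain ⟨F, hF⟩ : ∃ F : Submodule k (GluedAlgebra z₀ e),
      F = LieSubmodule.toSubmodule (maxTrivSubmodule k g (GluedAlgebra z₀ e)) := ⟨_, rfl⟩
  rw [← hF] at hcompl
  have hmemF : ∀ p, p ∈ F ↔ ∀ x, ρ x p = 0 := fun p => by rw [hF]; rfl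
  have hUρ : ∀ x p, ρ x p ∈ U := fun x p => by
    rw [← hU]
    exact Submodule.subset_span ⟨x, trivial, p, trivial, rfl⟩
  have hUle : ∀ Q : Submodule k (GluedAlgebra z₀ e), (∀ x p, ρ x p ∈ Q) → U ≤ Q := by
    intro Q hQ
    rw [← hU, Submodule.span_le]
    rintro _ ⟨x, -, p, -, rfl⟩
    exact hQ x p
  have hUW : ∀ p ∈ U, p.alg ∈ derivedIdeal k 𝔫 := fun p hp =>
    hUle ((derivedIdeal k 𝔫).toSubmodule.comap (algL z₀ e)) hA hp
  have hρW : ∀ x (p : GluedAlgebra z₀ e), p.alg ∈ derivedIdeal k 𝔫 →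
      ρ x p = ρ x (ofVec z₀ e p.vec) := by
    intro x p hp
    conv_lhs => rw [eq_ofAlg_add_ofVec p, map_add, hB x _ hp, zero_add]
  obtain ⟨π, hπ1, hπ2⟩ : ∃ π : End k (GluedAlgebra z₀ e), (∀ p, π p ∈ U) ∧
      (∀ p, p - π p ∈ F) := by
    refine ⟨U.projection F hcompl.symm, fun p => Submodule.projection_apply_mem _ p, fun p => ?_⟩
    exact Submodule.sub_projection_mem _ p
  have huniq : ∀ p q, q ∈ U → p - q ∈ F → π p = q := by
    intro p q hq hpq
    have h1 : π p - q ∈ U := sub_mem (hπ1 p) hq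
    have h2 : π p - q ∈ F := by
      have := sub_mem hpq (hπ2 p)
      rwa [sub_sub_sub_cancel_left] at this
    exact sub_eq_zero.1 (Submodule.disjoint_def.1 hcompl.disjoint _ h2 h1)
  -- `U` is already spanned by the `ρ x v` with `v ∈ V`: modulo invariants `p` lies in `U ⊆ 𝔫² + V`,
  -- and `𝔫²` is killed.
  have hUle' : ∀ Q : Submodule k (GluedAlgebra z₀ e), (∀ x v, ρ x (ofVec z₀ e v) ∈ Q) →
      U ≤ Q := by
    intro Q hQ
    refine hUle Q fun x p => ?_
    have := (hmemF _).1 (hπ2 p) x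
    rw [map_sub, sub_eq_zero] at this
    rw [this, hρW x _ (hUW _ (hπ1 p))]
    exact hQ _ _
  have hπF : ∀ p ∈ F, π p = 0 := fun p hp => huniq p 0 (zero_mem _) (by rwa [sub_zero])
  have hNF : ∀ c ∈ derivedIdeal k 𝔫, ofAlg z₀ e c ∈ F := fun c hc => (hmemF _).2 fun x => hB x c hc
  have hγρ : ∀ x u, π (ofVec z₀ e (ρ x (ofVec z₀ e u)).vec) = ρ x (ofVec z₀ e u) := by
    intro x u
    refine huniq _ _ (hUρ _ _) ?_
    have : ofVec z₀ e (ρ x (ofVec z₀ e u)).vec - ρ x (ofVec z₀ e u) =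
        -ofAlg z₀ e (ρ x (ofVec z₀ e u)).alg := by ext <;> simp
    rw [this]
    exact neg_mem (hNF _ (hA _ _))
  have hβρ : ∀ x a, ρ x (ofAlg z₀ e a + ofVec z₀ e (-(π (ofAlg z₀ e a)).vec)) = 0 := by
    intro x a
    have h1 := (hmemF _).1 (hπ2 (ofAlg z₀ e a)) x
    rw [map_sub, hρW x _ (hUW _ (hπ1 _))] at h1
    rw [map_neg, map_add, map_neg, ← sub_eq_add_neg, h1]
  -- With `π` the projection onto `U` along `F`, `γ` moves the `V`-components of `U` back into `U`,
  -- and `β` corrects `a ∈ 𝔫` by a vector of `V` to an invariant.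
  refine ⟨-(vecL z₀ e ∘ₗ π ∘ₗ (ofAlg z₀ e : 𝔫 →ₗ[k] GluedAlgebra z₀ e)),
    algL z₀ e ∘ₗ π ∘ₗ ofVec z₀ e, fun u => hUW _ (hπ1 _), fun a ha => ?_, fun u a => ?_,
    fun x u => (congrArg alg (hγρ x u)).symm, hβρ⟩
  · have h0 : π (ofAlg z₀ e a) = 0 := hπF _ (hNF a ha)
    simp [h0]
  · obtain ⟨b, hb⟩ : ∃ b : V, b = -(π (ofAlg z₀ e a)).vec := ⟨_, rfl⟩
    change ⁅(π (ofVec z₀ e u)).alg, a⁆ = -(sympForm e u (-(π (ofAlg z₀ e a)).vec) • (z₀ : 𝔫))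
    have hbx : ∀ x, (ρ x (ofAlg z₀ e a)).vec = -(ρ x (ofVec z₀ e b)).vec := by
      intro x
      have h1 := hβρ x a
      rw [← hb, map_add] at h1
      rw [eq_neg_of_add_eq_zero_left h1]
      rfl
    -- On `U` the relation `[a, p.alg] = b(p.vec, β a) z₀` follows from the Leibniz rule and the
    -- skewness of the action on `V`.
    have h1 : U ≤ LinearMap.ker ((LieModule.toEnd k 𝔫 𝔫 a : 𝔫 →ₗ[k] 𝔫) ∘ₗ algL z₀ e -
        (((sympForm e).flip b).smulRight (z₀ : 𝔫)) ∘ₗ vecL z₀ e) := by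
      refine hUle' _ fun x v => ?_
      rw [LinearMap.mem_ker]
      change ⁅a, (ρ x (ofVec z₀ e v)).alg⁆ -
        sympForm e (ρ x (ofVec z₀ e v)).vec b • (z₀ : 𝔫) = 0
      have h2 : sympForm e (ρ x (ofVec z₀ e v)).vec b =
        -sympForm e v (ρ x (ofVec z₀ e b)).vec := hskew x v b
      rw [← lie_skew, lie_alg_apply_ofVec (hρ x), hbx, h2]
      simp
    -- By skewness, `V`-components of invariants in `𝔫² + V` are orthogonal to those of `U`, among
    -- them `β a`. Hence `u` may be replaced by the `V`-component of `π u` in `b(u, β a)`.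
    have h2 : ∀ p ∈ F, p.alg ∈ derivedIdeal k 𝔫 → sympForm e p.vec b = 0 := by
      intro p hp hpW
      have h3 : U ≤ LinearMap.ker (sympForm e p.vec ∘ₗ vecL z₀ e) := by
        refine hUle' _ fun x v => ?_
        rw [LinearMap.mem_ker]
        change sympForm e p.vec (ρ x (ofVec z₀ e v)).vec = 0
        have h4 : sympForm e (ρ x (ofVec z₀ e p.vec)).vec v =
          -sympForm e p.vec (ρ x (ofVec z₀ e v)).vec := hskew x p.vec v
        rw [← hρW x p hpW, (hmemF p).1 hp x] at h4
        simpa using h4.symm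
      have h5 : sympForm e p.vec (π (ofAlg z₀ e a)).vec = 0 := h3 (hπ1 _)
      rw [hb, map_neg, h5, neg_zero]
    rw [← hb]
    have h3 : ⁅a, (π (ofVec z₀ e u)).alg⁆ - sympForm e (π (ofVec z₀ e u)).vec b • (z₀ : 𝔫) = 0 :=
      h1 (hπ1 (ofVec z₀ e u))
    have h4 := h2 _ (hπ2 (ofVec z₀ e u)) (by
      rw [sub_alg, ofVec_alg, zero_sub]
      exact neg_mem (hUW _ (hπ1 _)))
    rw [sub_vec, ofVec_vec, map_sub, LinearMap.sub_apply, sub_eq_zero] at h4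
    rw [h4, ← lie_skew, sub_eq_zero.1 h3]

/-- A semisimple algebra of derivations of `ℒ_n(𝔫, z₀)` is conjugate to a subalgebra of
`𝔰𝔭(V_n, b)^⋆`. -/
theorem exists_conj_mem_spStar (hz₀ : z₀ ≠ 0) (hn : 1 ≤ n) :
    ∃ φ : GluedAlgebra z₀ e ≃ₗ⁅k⁆ GluedAlgebra z₀ e, ∀ x,
      (φ : GluedAlgebra z₀ e ≃ₗ[k] GluedAlgebra z₀ e).conj (ρ x) ∈ spStar z₀ e := by
  obtain ⟨β, γ, hγ, hβ, hβγ, h1, h2⟩ := exists_odd_components h_center hs ρ hρ hz₀ hn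
  have hB := fun x c => apply_ofAlg_eq_zero_of_hasTrivialRadical h_center hs ρ hρ x (c := c)
  let E := expOdd z₀ e β γ
  let E' := expOdd z₀ e (-β) (-γ)
  have hE'E : ∀ p, E' (E p) = p := expOdd_neg_apply_expOdd hγ hβ
  have hEE' : ∀ p, E (E' p) = p := fun p => by
    have := expOdd_neg_apply_expOdd (β := -β) (γ := -γ) (z₀ := z₀) (e := e)
      (fun u => neg_mem (hγ u)) (fun a ha => by simp [hβ a ha]) p
    rwa [neg_neg, neg_neg] at this
  let ψ : GluedAlgebra z₀ e ≃ₗ⁅k⁆ GluedAlgebra z₀ e :=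
    { E with
      map_lie' := fun {p q} => expOdd_lie hγ hβ hβγ h_center p q
      invFun := E'
      left_inv := hE'E
      right_inv := hEE' }
  refine ⟨ψ.symm, fun x => ⟨⟨_, skew_of_mem_der hs hz₀ hn (hρ x), fun u => ?_⟩,
    fun a => ?_⟩⟩
  · change E' (ρ x (E (ofVec z₀ e u))) = ofVec z₀ e (ρ x (ofVec z₀ e u)).vec
    have h3 : ∀ w, E (ofVec z₀ e w) = ofAlg z₀ e (γ w) + ofVec z₀ e w := fun w => by
      ext <;> simp [E, expOdd]
    rw [h3, map_add, hB x _ (hγ u), zero_add]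
    have h4 : ρ x (ofVec z₀ e u) = E (ofVec z₀ e (ρ x (ofVec z₀ e u)).vec) := by
      rw [h3, ← h1]
      exact eq_ofAlg_add_ofVec _
    exact (congrArg E' h4).trans (hE'E _)
  · change E' (ρ x (E (ofAlg z₀ e a))) = 0
    have h3 : E (ofAlg z₀ e a) =
        ofAlg z₀ e ((2⁻¹ : k) • γ (β a)) + (ofAlg z₀ e a + ofVec z₀ e (β a)) := by
      ext <;> simp [E, expOdd, add_comm]
    rw [h3, map_add, h2, hB x _ (Submodule.smul_mem _ _ (hγ _)), add_zero, map_zero]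

end Conjugation

end CharNilp.GluedAlgebra

/-- Semisimplicity is carried to the image through nondegeneracy of the Killing form. -/
theorem LieHom.hasTrivialRadical_range {k : Type*} [Field k] [CharZero k] {g : Type*} [LieRing g]
    [LieAlgebra k g] [FiniteDimensional k g] [HasTrivialRadical k g] {L : Type*} [LieRing L]
    [LieAlgebra k L] (s : g →ₗ⁅k⁆ L) (hs : Function.Injective s) :
    HasTrivialRadical k s.range := by
  have f : g ≃ₗ⁅k⁆ s.range := LieEquiv.ofInjective s hs
  have := f.isKilling
  have : FiniteDimensional k s.range := Module.Finite.equiv (f : g ≃ₗ[k] s.range)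
  infer_instance

/-! ### Semidirect sums over the radical -/

namespace CharNilp

/-- The image of a section of the quotient by the radical is a Levi subalgebra. -/
theorem isLeviSubalgebra_range {k : Type*} [Field k] [CharZero k] {g : Type*} [LieRing g]
    [LieAlgebra k g] [FiniteDimensional k g] [HasTrivialRadical k g] {L : Type*} [LieRing L]
    [LieAlgebra k L] (p : L →ₗ⁅k⁆ g) (hp : p.ker = radical k L) (s : g →ₗ⁅k⁆ L)
    (hs : ∀ y, p (s y) = y) : IsLeviSubalgebra k s.range := by
  refine ⟨s.hasTrivialRadical_range (Function.LeftInverse.injective hs), ?_⟩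
  rw [← hp]
  constructor
  · rw [Submodule.disjoint_def]
    rintro _ ⟨y, rfl⟩ hy
    have hy' : p (s y) = 0 := hy
    rw [hs] at hy'
    rw [hy']
    exact s.map_zero
  · rw [codisjoint_iff, eq_top_iff]
    intro y _
    have h : s (p y) + (y - s (p y)) = y := by abel
    rw [← h]
    refine Submodule.add_mem_sup ⟨p y, rfl⟩ ?_
    change p (y - s (p y)) = 0
    rw [map_sub, hs, sub_self]

variable {k : Type u} [Field k] {R : Type v} [LieRing R] [LieAlgebra k R]
  {L : Type x} [LieRing L] [LieAlgebra k L]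
  {g : Type w} [LieRing g] [LieAlgebra k g]

/-- The action of a subalgebra complementary to the radical on an isomorphic copy of the
radical. -/
noncomputable def radicalAction (s : g →ₗ⁅k⁆ L) (Θ : radical k L ≃ₗ⁅k⁆ R) :
    g →ₗ⁅k⁆ LieDerivation k R R where
  toFun y :=
    { toLinearMap := (Θ : radical k L ≃ₗ[k] R).conj (toEnd k L (radical k L) (s y))
      leibniz' := fun a b => by
        obtain ⟨a, rfl⟩ : ∃ a', Θ a' = a := Θ.surjective a
        obtain ⟨b, rfl⟩ : ∃ b', Θ b' = b := Θ.surjective b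
        have h : ∀ r, (Θ : radical k L ≃ₗ[k] R).conj (toEnd k L (radical k L) (s y)) (Θ r) =
            Θ ⁅s y, r⁆ := fun r => by
          rw [LinearEquiv.conj_apply_apply]
          exact congrArg (fun z => Θ ⁅s y, z⁆) (Θ.symm_apply_apply r)
        rw [← LieEquiv.map_lie, h, h, h, ← LieEquiv.map_lie, ← LieEquiv.map_lie, ← map_sub]
        congr 1
        ext
        simp only [LieSubmodule.coe_bracket, LieIdeal.coe_bracket_of_module, LieSubmodule.coe_sub]
        rw [leibniz_lie, ← lie_skew (b : L) ⁅s y, (a : L)⁆]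
        abel }
  map_add' a b := by ext; simp
  map_smul' c a := by ext; simp
  map_lie' {a b} := by
    ext r
    obtain ⟨r, rfl⟩ : ∃ r', Θ r' = r := Θ.surjective r
    change Θ ⁅s ⁅a, b⁆, Θ.symm (Θ r)⁆ = Θ ⁅s a, Θ.symm (Θ ⁅s b, Θ.symm (Θ r)⁆)⁆ -
      Θ ⁅s b, Θ.symm (Θ ⁅s a, Θ.symm (Θ r)⁆)⁆
    simp only [LieEquiv.symm_apply_apply, LieHom.map_lie, lie_lie, map_sub]

theorem radicalAction_apply_apply (s : g →ₗ⁅k⁆ L) (Θ : radical k L ≃ₗ⁅k⁆ R) (y : g)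
    (r : radical k L) : radicalAction s Θ y (Θ r) = Θ ⁅s y, r⁆ :=
  congrArg (fun z => Θ ⁅s y, z⁆) (Θ.symm_apply_apply r)

/-- A Lie algebra with a Levi subalgebra acting faithfully on the radical is the semidirect sum of
the radical and an algebra of derivations of it. -/
theorem nonempty_equiv_semiDirectSum (p : L →ₗ⁅k⁆ g) (hp : p.ker = radical k L) (s : g →ₗ⁅k⁆ L)
    (hs : ∀ y, p (s y) = y) (Θ : radical k L ≃ₗ⁅k⁆ R)
    (hinj : Function.Injective (radicalAction s Θ)) :
    Nonempty (L ≃ₗ⁅k⁆ SemiDirectSum R (radicalAction s Θ).range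
      (radicalAction s Θ).range.incl) := by
  have hmem : ∀ y, y - s (p y) ∈ radical k L := fun y => by
    rw [← hp, LieHom.mem_ker, map_sub, hs, sub_self]
  -- The component of `y` in the radical with respect to `L = s(g) ⊕ Rad L`.
  let c : L → radical k L := fun y => ⟨y - s (p y), hmem y⟩
  let τ := radicalAction s Θ
  let F : L →ₗ⁅k⁆ SemiDirectSum R τ.range τ.range.incl :=
    { toFun := fun y => ⟨Θ (c y), ⟨τ (p y), p y, rfl⟩⟩
      map_add' := fun y z => by
        have : c (y + z) = c y + c z := Subtype.ext (by simp [c]; abel)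
        ext
        · simp [this]
        · simp
      map_smul' := fun a y => by
        have : c (a • y) = a • c y := Subtype.ext (by simp [c, smul_sub])
        ext
        · simp [this]
        · simp
      map_lie' := fun {y z} => by
        have : c ⁅y, z⁆ = ⁅c y, c z⁆ + ⁅s (p y), c z⁆ - ⁅s (p z), c y⁆ := Subtype.ext (by
          simp [c]
          rw [← lie_skew y (s (p z)), ← lie_skew (s (p y)) (s (p z))]
          abel)
        ext
        · change Θ (c ⁅y, z⁆) =
            ⁅Θ (c y), Θ (c z)⁆ + τ (p y) (Θ (c z)) - τ (p z) (Θ (c y))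
          rw [this, map_sub, map_add, LieEquiv.map_lie, radicalAction_apply_apply,
            radicalAction_apply_apply]
        · simp }
  refine ⟨LieEquiv.ofBijective F ⟨?_, ?_⟩⟩
  · rw [injective_iff_map_eq_zero]
    intro y hy
    have h1 : (F y).right = 0 := by rw [hy]; rfl
    have h2 : (F y).left = 0 := by rw [hy]; rfl
    have h3 : p y = 0 := hinj ((congrArg Subtype.val h1).trans (map_zero _).symm)
    have h4 : c y = 0 := Θ.injective (h2.trans (map_zero Θ).symm)
    have h5 : y - s (p y) = 0 := congrArg Subtype.val h4
    rwa [h3, map_zero, sub_zero] at h5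
  · rintro ⟨a, ⟨_, y, rfl⟩⟩
    obtain ⟨r, rfl⟩ := Θ.surjective a
    have h1 : p r = 0 := by
      have : (r : L) ∈ p.ker := by rw [hp]; exact r.2
      exact this
    have h2 : p (r + s y) = y := by rw [map_add, h1, hs, zero_add]
    refine ⟨r + s y, ?_⟩
    have h3 : c (r + s y) = r := Subtype.ext (by simp [c, h1, hs])
    ext1
    · exact congrArg Θ h3
    · exact Subtype.ext (congrArg τ h2)

end CharNilp

/-! ### Faithful Lie algebras with radical `ℒ_n`, and the theorem -/

open CharNilp CharNilp.GluedAlgebra in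
theorem exists_semiDirectSum_of_isFaithfulLie {k : Type u} [Field k] [CharZero k]
    {𝔫 : Type v} [LieRing 𝔫] [LieAlgebra k 𝔫] [FiniteDimensional k 𝔫]
    (h_char : IsCharNilpotent k 𝔫)
    (h_center : ∀ a : 𝔫, (∀ c : 𝔫, ⁅a, c⁆ ∈ LieAlgebra.center k 𝔫) → a ∈ derivedIdeal k 𝔫)
    (z₀ : LieAlgebra.center k 𝔫) (hz₀ : z₀ ≠ 0)
    {n : ℕ} (hn : 1 ≤ n)
    {V : Type w} [AddCommGroup V] [Module k V] (e : Module.Basis (Fin n ⊕ Fin n) k V)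
    (L : Type x) [LieRing L] [LieAlgebra k L] [FiniteDimensional k L] (hL : IsFaithfulLie k L)
    (Θ : LieAlgebra.radical k L ≃ₗ⁅k⁆ GluedAlgebra z₀ e) :
    ∃ S : LieSubalgebra k (LieDerivation k (GluedAlgebra z₀ e) (GluedAlgebra z₀ e)),
      LieAlgebra.HasTrivialRadical k S ∧
      (∀ δ ∈ S, δ.toLinearMap ∈ spStar z₀ e) ∧
      Nonempty (L ≃ₗ⁅k⁆ LieAlgebra.SemiDirectSum (GluedAlgebra z₀ e) S S.incl) := by
  obtain ⟨d, hd⟩ := h_char.exists_pow_eq_zero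
  let p := (radical k L).quotientMk
  have hp : p.ker = radical k L := (radical k L).ker_quotientMk
  have hps : Function.Surjective p := (radical k L).quotientMk_surjective
  have : FiniteDimensional k (L ⧸ radical k L) :=
    inferInstanceAs (FiniteDimensional k (L ⧸ (radical k L).toSubmodule))
  have : HasTrivialRadical k (L ⧸ radical k L) := p.hasTrivialRadical_of_ker_eq_radical hps hp
  have : LieAlgebra.IsSolvable p.ker := by rw [hp]; infer_instance
  obtain ⟨s, hs⟩ := p.exists_section_of_isSolvable_ker hps
  have hinj := hL s.range (isLeviSubalgebra_range p hp s hs)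
  obtain ⟨φ, hφ⟩ := exists_conj_mem_spStar h_center hd
    ((LieDerivation.toLinearMapLieHom k _).comp (radicalAction s Θ)) (fun y => ⟨_, rfl⟩) hz₀ hn
  -- Changing the identification of the radical by `φ` conjugates the action, so that it lands in
  -- `𝔰𝔭(V_n, b)^⋆` itself.
  let Θ' := Θ.trans φ
  have hinj' : Function.Injective (radicalAction s Θ') := by
    intro y y' h
    have h1 : (⟨s y, y, rfl⟩ : s.range) = ⟨s y', y', rfl⟩ := by
      refine hinj (LinearMap.ext fun r => Θ'.injective ?_)
      have := LieDerivation.congr_fun h (Θ' r)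
      rw [radicalAction_apply_apply, radicalAction_apply_apply] at this
      exact this
    exact Function.LeftInverse.injective hs (congrArg Subtype.val h1)
  refine ⟨(radicalAction s Θ').range, (radicalAction s Θ').hasTrivialRadical_range hinj', ?_,
    nonempty_equiv_semiDirectSum p hp s hs Θ' hinj'⟩
  rintro _ ⟨y, rfl⟩
  exact hφ y

end

open CharNilp CharNilp.GluedAlgebra in
theorem mainTheorem7 {k : Type u} [Field k] [CharZero k]
    {𝔫 : Type v} [LieRing 𝔫] [LieAlgebra k 𝔫] [FiniteDimensional k 𝔫]
    (h_char : IsCharNilpotent k 𝔫)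
    (h_center : ∀ a : 𝔫, (∀ c : 𝔫, ⁅a, c⁆ ∈ LieAlgebra.center k 𝔫) → a ∈ derivedIdeal k 𝔫)
    (z₀ : LieAlgebra.center k 𝔫) (hz₀ : z₀ ≠ 0)
    {n : ℕ} (hn : 1 ≤ n)
    {V : Type w} [AddCommGroup V] [Module k V] (e : Module.Basis (Fin n ⊕ Fin n) k V) :
    -- `ℒ_n(𝔫, z₀)` is nilpotent of the same nilindex as `𝔫`
    (LieRing.IsNilpotent 𝔫 ∧ LieRing.IsNilpotent (GluedAlgebra z₀ e) ∧
      LieModule.nilpotencyLength (GluedAlgebra z₀ e) (GluedAlgebra z₀ e) =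
        LieModule.nilpotencyLength 𝔫 𝔫) ∧
    -- `Der ℒ_n = 𝔰𝔭(V_n, b)^⋆ ⊕ 𝔑`, and `𝔑` is the direct sum of its two parts
    ((der z₀ e).toSubmodule = (spStar z₀ e).toSubmodule ⊔ nilPart z₀ e ∧
      Disjoint (spStar z₀ e).toSubmodule (nilPart z₀ e) ∧
      Disjoint (nilEven z₀ e) (nilOdd z₀ e)) ∧
    -- `𝔑` is a nilpotent ideal of `Der ℒ_n`, consisting of nilpotent operators
    ((∃ I : LieIdeal k (der z₀ e), LieRing.IsNilpotent I ∧
        I.toSubmodule.map (der z₀ e).toSubmodule.subtype = nilPart z₀ e) ∧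
      ∀ δ ∈ nilPart z₀ e, IsNilpotent δ) ∧
    -- faithful Lie algebras with radical `ℒ_n` are of the form `S ⊕_id ℒ_n`
    (∀ (L : Type x) [LieRing L] [LieAlgebra k L] [FiniteDimensional k L],
      IsFaithfulLie k L →
      Nonempty (LieAlgebra.radical k L ≃ₗ⁅k⁆ GluedAlgebra z₀ e) →
      ∃ S : LieSubalgebra k (LieDerivation k (GluedAlgebra z₀ e) (GluedAlgebra z₀ e)),
        LieAlgebra.HasTrivialRadical k S ∧
        (∀ δ ∈ S, δ.toLinearMap ∈ spStar z₀ e) ∧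
        Nonempty (L ≃ₗ⁅k⁆ LieAlgebra.SemiDirectSum (GluedAlgebra z₀ e) S S.incl)) := by
  obtain ⟨d, hd⟩ := h_char.exists_pow_eq_zero
  have h_nil : LieRing.IsNilpotent 𝔫 := h_char.isNilpotent
  refine ⟨⟨h_nil, isNilpotent_of_isNilpotent h_center hz₀ h_nil,
      nilpotencyLength_eq h_center hz₀⟩,
    ⟨der_eq_spStar_sup_nilPart h_center hd hz₀ hn, disjoint_spStar_nilPart,
      disjoint_nilEven_nilOdd⟩,
    ⟨⟨nilIdeal h_center hd hz₀ hn, isNilpotent_nilIdeal h_center hd hz₀ hn,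
      map_nilIdeal h_center hd hz₀ hn⟩,
      fun δ hδ => isNilpotent_of_mem_nilPart h_center hd hδ⟩, ?_⟩
  rintro L _ _ _ hL ⟨Θ⟩
  exact exists_semiDirectSum_of_isFaithfulLie h_char h_center z₀ hz₀ hn e L hL Θ
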